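/- Let $N\ge 2$ be an integer, let $0<\lambda\le\Lambda$, and let $g:\mathbb R\to\mathbb R$ be locally Lipschitz and odd, differentiable at $0$ with $g'(0)>0$. Suppose that $\alpha\in(0,+\infty]$ is such that $g$ is positive on $(0,\alpha)$ and negative on $(\alpha,+\infty)$. Put $G(t)=\int_0^t g(s)\,ds$, with $G(+\infty)=\lim_{t\to+\infty}G(t)\in(0,+\infty]$ if $\alpha=+\infty$. For $\xi\in\mathbb R$ consider the Cauchy problem $$\psi\,u''+\frac{N-1}{r}\,\Psi\,u'+g(u)=0,\qquad u(0)=\xi,\qquad u'(0)=0,$$ which is satisfied by the radial solutions $u=u(|x|)$ of $\mathcal M^-_{\lambda,\Lambda}(D^2u)+g(u)=0$ in dimension $N$; here $\psi=\lambda$ where $u''\ge 0$ and $\psi=\Lambda$ where $u''<0$, and $\Psi=\lambda$ where $u'\ge 0$ and $\Psi=\Lambda$ where $u'<0$, the equation being required for $r>0$. Call a function $u$ on $[0,+\infty)$ *oscillating* if it has an unbounded sequence of zeros, and *localized* if $u$, $u'$ and $u''$ tend to $0$ at $+\infty$. Then for every $\xi\in\mathbb R$ there is a solution $u_\xi\in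 C^2([0,R_\xi))$ of the Cauchy problem, where $R_\xi\in(0,+\infty]$ and $[0,R_\xi)$ is its maximal interval of existence (that is, $u_\xi$ does not extend to a solution on a larger interval $[0,R')$). Moreover, every such maximal solution has the following properties. 1. If $|\xi|=\alpha<+\infty$ or $\xi=0$, then $u_\xi\equiv\xi$. 2. If $\alpha<+\infty$ and $|\xi|>\alpha$, then $|u_\xi|$ is strictly increasing on $[0,R_\xi)$ and $|u_\xi(r)|\to+\infty$ as $r\to R_\xi^-$. 3. If $0<\xi<\alpha$, then $R_\xi=+\infty$ and $u_\xi$ is oscillating and localized, with $\|u_\xi\|_{L^\infty(\mathbb R_+)}=\xi<\alpha$. 4. If $-\alpha<\xi<0$ and $\Lambda G(\xi)\le\lambda G(\alpha)$, then $R_\xi=+\infty$ and $u_\xi$ is oscillating and localized, with $\|u_\xi\|_{L^\infty(\mathbb R_+)}<\alpha$. -/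

import Mathlib

open MeasureTheory Filter Topology Set

noncomputable section

namespace PucciRadial

/-- The potential `G t = ∫₀ᵗ g(s) ds`. -/
def potential (g : ℝ → ℝ) (t : ℝ) : ℝ := ∫ s in (0 : ℝ)..t, g s

/-- The value `G(α)` for `α ∈ (0, +∞]`: it is `∫₀^α g(s) ds` for finite `α`, and the limit of
`G(t)` as `t → +∞`, possibly `+∞`, for `α = +∞` (`G` is increasing in that case under the sign
hypothesis on `g`, so the upper limit is the limit). -/
def potentialAt (g : ℝ → ℝ) (α : EReal) : EReal :=
  if α = ⊤ then limsup (fun t : ℝ => ((potential g t : ℝ) : EReal)) atTop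
  else ((potential g α.toReal : ℝ) : EReal)

/-- The coefficient with which the operator `M⁻` weighs a quantity `s`:
`lam` when `s ≥ 0` and `Lam` when `s < 0`. -/
def coeffMinus (lam Lam s : ℝ) : ℝ := if 0 ≤ s then lam else Lam

/-- The interval `[0, R)` for `R ∈ (0, +∞]`. -/
def dom (R : EReal) : Set ℝ := {r : ℝ | 0 ≤ r ∧ (r : EReal) < R}

/-- `u` is a solution of class `C²([0, R))` of the radial Cauchy problem
`ψ u'' + ((N - 1) / r) Ψ u' + g(u) = 0`, `u(0) = ξ`, `u'(0) = 0`, where `ψ` is `lam` where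
`u'' ≥ 0` and `Lam` where `u'' < 0`, and `Ψ` is `lam` where `u' ≥ 0` and `Lam` where `u' < 0`.
Only the values of `u` on `[0, R)` matter; the derivative at `0` is one-sided, and the equation is
required at the points `0 < r < R`. -/
structure IsSolution (N : ℕ) (lam Lam : ℝ) (g : ℝ → ℝ) (ξ : ℝ) (R : EReal) (u : ℝ → ℝ) :
    Prop where
  pos : 0 < R
  contDiffOn : ContDiffOn ℝ 2 u (dom R)
  init : u 0 = ξ
  init_deriv : HasDerivWithinAt u 0 (Ici 0) 0
  eqn : ∀ r : ℝ, 0 < r → (r : EReal) < R →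
    coeffMinus lam Lam (deriv (deriv u) r) * deriv (deriv u) r
      + ((N : ℝ) - 1) / r * coeffMinus lam Lam (deriv u r) * deriv u r + g (u r) = 0

/-- `u` is a solution on `[0, R)` that has no extension to a solution on a larger interval, i.e.
`[0, R)` is the maximal interval where `u` is defined. -/
def IsMaximalSolution (N : ℕ) (lam Lam : ℝ) (g : ℝ → ℝ) (ξ : ℝ) (R : EReal) (u : ℝ → ℝ) : Prop :=
  IsSolution N lam Lam g ξ R u ∧
    ∀ (R' : EReal) (v : ℝ → ℝ), R < R' → EqOn v u (dom R) →
      ¬ IsSolution N lam Lam g ξ R' v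

/-- `u : [0, +∞) → ℝ` has an unbounded sequence of zeros. -/
def Oscillating (u : ℝ → ℝ) : Prop :=
  ∃ z : ℕ → ℝ, (∀ n, 0 ≤ z n) ∧ (∀ n, u (z n) = 0) ∧ ¬ BddAbove (range z)

/-- `u : [0, +∞) → ℝ` converges to zero at infinity together with its derivatives up to
order two. -/
def Localized (u : ℝ → ℝ) : Prop :=
  Tendsto u atTop (𝓝 0) ∧ Tendsto (deriv u) atTop (𝓝 0) ∧
    Tendsto (deriv (deriv u)) atTop (𝓝 0)

/-- The norm `‖u‖_{L^∞(ℝ₊)}`, as an extended real. -/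
def supNorm (u : ℝ → ℝ) : EReal :=
  ((eLpNorm u ⊤ (volume.restrict (Ioi (0 : ℝ))) : ENNReal) : EReal)

/-- `|u|` is strictly increasing on `[0, R)` and tends to `+∞` at `R`. -/
def AbsIncreasesToInfinity (R : EReal) (u : ℝ → ℝ) : Prop :=
  StrictMonoOn (fun r => |u r|) (dom R) ∧
    ∀ M : ℝ, ∃ r₀ ∈ dom R, ∀ r ∈ dom R, r₀ ≤ r → M < |u r|

end PucciRadial

end

open scoped BoundedContinuousFunction

/-! Write a = λ, b = Λ, n = N - 1, p = u'. Since s ↦ ψ s is piecewise linear and invertible, the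
equation becomes u'' = `acc`, and -u'' at p = 0 is the `force` f(u): g/b where g ≥ 0, g/a where g <
0. With H the primitive of f, the energy E = p²/2 + H(u) satisfies E' ≤ -c p²/r
(`mul_acc_add_force_le`). A level β with H(β) > E can therefore never be reached
(`RadialODE.ne_of_energy_lt`).

For 0 ≤ x < α one has H(x) = G(x)/b and H(-x) = G(x)/a. As a ≤ b, a start at ξ > 0 is confined on
both sides without further condition. A start at ξ < 0 has energy G(ξ)/a, to be compared with
G(α)/b; this is the hypothesis of case 4, and equality is allowed because energy is lost strictly
(`RadialODE.energy_lt`).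

Bounded solutions are global, as the only obstruction is blow-up
(`IsMaximalSolution.eq_top_of_bounded`). They decay: adding (c/2) u u'/r to E gives a quantity whose
derivative is at most -const/r + O(1/r²) as long as E stays away from 0, and ∫ dr/r diverges
(`RadialODE.exists_energy_lt`). They oscillate: if u stayed positive, y = -u'/u would satisfy y' ≥
(y² + σ²)/2 and blow up in finite time (`RadialODE.not_eventually_pos`); the negative case follows
by oddness, with a and b exchanged. Above α the force points outwards and u' grows at least linearly
on bounded ranges of u, so u cannot stay bounded (`RadialODE.strictMonoOn_and_unbounded`).

The singular term n/r is harmless for uniqueness because the damping is monotone in p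
(`acc_sub_mul_le`). For existence near 0, u' and u'' both have the sign opposite to g(ξ), so the
coefficients are one constant and the problem is a contraction (`exists_isSolution`). -/

namespace PucciRadial

/-! ### Piecewise linear functions and a Grönwall inequality -/

/-- The piecewise linear function with slope `a` on `[0, ∞)` and slope `b` on `(-∞, 0)`. -/
noncomputable def pl (a b s : ℝ) : ℝ := coeffMinus a b s * s

theorem pl_of_nonneg {a b s : ℝ} (hs : 0 ≤ s) : pl a b s = a * s := by
  simp [pl, coeffMinus, hs]

theorem pl_of_nonpos {a b s : ℝ} (hs : s ≤ 0) : pl a b s = b * s := by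
  rcases hs.eq_or_lt with rfl | h
  · simp [pl]
  · simp [pl, coeffMinus, not_le.mpr h]

@[simp] theorem pl_zero (a b : ℝ) : pl a b 0 = 0 := by simp [pl]

theorem pl_neg (a b s : ℝ) : pl a b (-s) = -pl b a s := by
  rcases le_total 0 s with h | h
  · rw [pl_of_nonneg h, pl_of_nonpos (by linarith)]; ring
  · rw [pl_of_nonpos h, pl_of_nonneg (by linarith)]; ring

theorem pl_mul_of_nonneg (a b : ℝ) {c : ℝ} (hc : 0 ≤ c) (s : ℝ) :
    pl a b (c * s) = c * pl a b s := by
  rcases le_total 0 s with h | h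
  · rw [pl_of_nonneg h, pl_of_nonneg (by positivity)]; ring
  · rw [pl_of_nonpos h, pl_of_nonpos (mul_nonpos_of_nonneg_of_nonpos hc h)]; ring

theorem le_pl_sub {a b k x y : ℝ} (ha : k ≤ a) (hb : k ≤ b) (hxy : x ≤ y) :
    k * (y - x) ≤ pl a b y - pl a b x := by
  rcases le_total 0 x with hx | hx <;> rcases le_total 0 y with hy | hy
  · rw [pl_of_nonneg hx, pl_of_nonneg hy]; nlinarith
  · rw [pl_of_nonneg hx, pl_of_nonpos hy]; nlinarith
  · rw [pl_of_nonpos hx, pl_of_nonneg hy]; nlinarith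
  · rw [pl_of_nonpos hx, pl_of_nonpos hy]; nlinarith

theorem pl_sub_le {a b K x y : ℝ} (ha : a ≤ K) (hb : b ≤ K) (hxy : x ≤ y) :
    pl a b y - pl a b x ≤ K * (y - x) := by
  rcases le_total 0 x with hx | hx <;> rcases le_total 0 y with hy | hy
  · rw [pl_of_nonneg hx, pl_of_nonneg hy]; nlinarith
  · rw [pl_of_nonneg hx, pl_of_nonpos hy]; nlinarith
  · rw [pl_of_nonpos hx, pl_of_nonneg hy]; nlinarith
  · rw [pl_of_nonpos hx, pl_of_nonpos hy]; nlinarith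

theorem pl_mono {a b : ℝ} (ha : 0 ≤ a) (hb : 0 ≤ b) : Monotone (pl a b) := fun x y h => by
  have := le_pl_sub ha hb h
  linarith

theorem pl_pl_inv {a b : ℝ} (ha : 0 < a) (hb : 0 < b) (s : ℝ) : pl a b (pl a⁻¹ b⁻¹ s) = s := by
  rcases le_total 0 s with h | h
  · rw [pl_of_nonneg h, pl_of_nonneg (by positivity)]; field_simp
  · rw [pl_of_nonpos h, pl_of_nonpos (mul_nonpos_of_nonneg_of_nonpos (by positivity) h)]
    field_simp

theorem pl_inv_pl {a b : ℝ} (ha : 0 < a) (hb : 0 < b) (s : ℝ) : pl a⁻¹ b⁻¹ (pl a b s) = s := by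
  have := pl_pl_inv (inv_pos.mpr ha) (inv_pos.mpr hb) s
  simpa using this

theorem abs_pl_sub_le {a b K : ℝ} (ha : 0 ≤ a) (hb : 0 ≤ b) (haK : a ≤ K) (hbK : b ≤ K)
    (x y : ℝ) : |pl a b x - pl a b y| ≤ K * |x - y| := by
  rcases le_total x y with h | h
  · have h1 := pl_sub_le haK hbK h
    have h2 := pl_mono ha hb h
    rw [abs_sub_comm, abs_sub_comm x, abs_of_nonneg (by linarith), abs_of_nonneg (by linarith)]
    exact h1
  · have h1 := pl_sub_le haK hbK h
    have h2 := pl_mono ha hb h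
    rw [abs_of_nonneg (by linarith), abs_of_nonneg (by linarith)]
    exact h1

theorem abs_pl_le {a b K : ℝ} (ha : 0 ≤ a) (hb : 0 ≤ b) (haK : a ≤ K) (hbK : b ≤ K)
    (x : ℝ) : |pl a b x| ≤ K * |x| := by
  simpa using abs_pl_sub_le ha hb haK hbK x 0

theorem continuous_pl (a b : ℝ) : Continuous (pl a b) := by
  have : pl a b = fun s => a * max s 0 + b * min s 0 := by
    funext s
    rcases le_total 0 s with h | h
    · rw [pl_of_nonneg h, max_eq_left h, min_eq_right h]; ring
    · rw [pl_of_nonpos h, max_eq_right h, min_eq_left h]; ring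
  rw [this]
  fun_prop

theorem pl_pos {a b s : ℝ} (ha : 0 < a) (hs : 0 < s) : 0 < pl a b s := by
  rw [pl_of_nonneg hs.le]; positivity

theorem mul_pl_ge {a b k : ℝ} (ha : k ≤ a) (hb : k ≤ b) (s : ℝ) : k * s ^ 2 ≤ s * pl a b s := by
  rcases le_total 0 s with h | h
  · rw [pl_of_nonneg h]; nlinarith [mul_self_nonneg s]
  · rw [pl_of_nonpos h]; nlinarith [mul_self_nonneg s]

theorem antitoneOn_of_hasDerivAt_nonpos {D : Set ℝ} (hD : Convex ℝ D) {f f' : ℝ → ℝ}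
    (hf : ContinuousOn f D) (hf' : ∀ x ∈ interior D, HasDerivAt f (f' x) x)
    (h : ∀ x ∈ interior D, f' x ≤ 0) : AntitoneOn f D := by
  refine antitoneOn_of_deriv_nonpos hD hf
    (fun x hx => (hf' x hx).differentiableAt.differentiableWithinAt) fun x hx => ?_
  rw [(hf' x hx).deriv]
  exact h x hx

/-- A form of Grönwall's inequality. -/
theorem le_exp_of_hasDerivAt_le {E E' : ℝ → ℝ} {r₀ r₁ C D : ℝ} (hr : r₀ ≤ r₁)
    (hE : ContinuousOn E (Icc r₀ r₁)) (hE' : ∀ r ∈ Ioo r₀ r₁, HasDerivAt E (E' r) r)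
    (h : ∀ r ∈ Ioo r₀ r₁, E' r ≤ C * (E r + D)) :
    E r₁ + D ≤ (E r₀ + D) * Real.exp (C * (r₁ - r₀)) := by
  have key : AntitoneOn (fun r => (E r + D) * Real.exp (-(C * (r - r₀)))) (Icc r₀ r₁) := by
    refine antitoneOn_of_hasDerivAt_nonpos (convex_Icc _ _)
      (f' := fun r => (E' r - C * (E r + D)) * Real.exp (-(C * (r - r₀)))) ?_ ?_ ?_
    · exact (hE.add continuousOn_const).mul (by fun_prop)
    · rw [interior_Icc]
      intro r hr
      have h1 : HasDerivAt (fun r => -(C * (r - r₀))) (-(C * 1)) r :=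
        (((hasDerivAt_id r).sub_const r₀).const_mul C).neg
      refine (((hE' r hr).add_const D).mul h1.exp).congr_deriv ?_
      ring
    · rw [interior_Icc]
      intro r hr
      exact mul_nonpos_of_nonpos_of_nonneg (by linarith [h r hr]) (Real.exp_pos _).le
  have := key (left_mem_Icc.mpr hr) (right_mem_Icc.mpr hr) hr
  simp only [sub_self, mul_zero, neg_zero, Real.exp_zero, mul_one] at this
  have h2 := mul_le_mul_of_nonneg_right this (Real.exp_pos (C * (r₁ - r₀))).le
  rwa [mul_assoc, ← Real.exp_add, neg_add_cancel, Real.exp_zero, mul_one] at h2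

/-! ### The equation solved for u'', and uniqueness from r = 0 -/

/-- The second derivative prescribed by the radial equation; `n` stands for `N - 1`. -/
noncomputable def acc (n a b : ℝ) (g : ℝ → ℝ) (r u p : ℝ) : ℝ :=
  pl a⁻¹ b⁻¹ (-(n / r * pl a b p) - g u)

/-- The damping is monotone in the velocity, so its contribution has the good sign and drops out
whatever the size of n / r. What remains does not depend on r, so Grönwall can be started at the
singular point r = 0. -/
theorem acc_sub_mul_le {n a b k : ℝ} (hn : 0 ≤ n) (hk : 0 < k) (ha : k ≤ a) (hb : k ≤ b)
    (g : ℝ → ℝ) {r : ℝ} (hr : 0 < r) (u p v q : ℝ) :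
    (p - q) * (acc n a b g r u p - acc n a b g r v q) ≤ k⁻¹ * |p - q| * |g u - g v| := by
  wlog hpq : q ≤ p generalizing u p v q
  · have := this v q u p (le_of_not_ge hpq)
    rw [abs_sub_comm p, abs_sub_comm (g u)]
    linarith
  have ha0 : 0 < a := hk.trans_le ha
  have hb0 : 0 < b := hk.trans_le hb
  have hm : pl a b q ≤ pl a b p := pl_mono ha0.le hb0.le hpq
  have hnr : 0 ≤ n / r := by positivity
  have hA : n / r * pl a b q ≤ n / r * pl a b p := mul_le_mul_of_nonneg_left hm hnr
  have hle : acc n a b g r u p - acc n a b g r v q ≤ k⁻¹ * |g u - g v| := by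
    unfold acc
    rcases le_total (-(n / r * pl a b p) - g u) (-(n / r * pl a b q) - g v) with h | h
    · have := pl_mono (inv_pos.mpr ha0).le (inv_pos.mpr hb0).le h
      have h3 : 0 ≤ k⁻¹ * |g u - g v| := by positivity
      linarith
    · refine (pl_sub_le (inv_anti₀ hk ha) (inv_anti₀ hk hb) h).trans ?_
      refine mul_le_mul_of_nonneg_left ?_ (inv_pos.mpr hk).le
      have := neg_le_abs (g u - g v)
      linarith
  rw [abs_of_nonneg (sub_nonneg.mpr hpq)]
  calc _ ≤ (p - q) * (k⁻¹ * |g u - g v|) :=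
        mul_le_mul_of_nonneg_left hle (sub_nonneg.mpr hpq)
    _ = _ := by ring

theorem mul_acc_le {n a b k : ℝ} (hn : 0 ≤ n) (hk : 0 < k) (ha : k ≤ a) (hb : k ≤ b)
    {g : ℝ → ℝ} (hg : g 0 = 0) {r : ℝ} (hr : 0 < r) (u p : ℝ) :
    p * acc n a b g r u p ≤ k⁻¹ * |p| * |g u| := by
  have := acc_sub_mul_le hn hk ha hb g hr u p 0 0
  simpa [acc, hg] using this

theorem acc_neg {n a b : ℝ} {g : ℝ → ℝ} (hodd : ∀ s, g (-s) = -g s) (r u p : ℝ) :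
    acc n b a g r (-u) (-p) = -acc n a b g r u p := by
  unfold acc
  rw [← pl_neg, pl_neg b a, hodd]
  congr 1
  ring

theorem continuousOn_acc {n a b : ℝ} {g u p : ℝ → ℝ} (hg : Continuous g) {s : Set ℝ}
    (hs : ∀ r ∈ s, 0 < r) (hu : ContinuousOn u s) (hp : ContinuousOn p s) :
    ContinuousOn (fun r => acc n a b g r (u r) (p r)) s := by
  unfold acc
  refine (continuous_pl _ _).comp_continuousOn (ContinuousOn.sub (ContinuousOn.neg ?_) ?_)
  · exact (continuousOn_const.div continuousOn_id fun r hr => (hs r hr).ne').mul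
      ((continuous_pl _ _).comp_continuousOn hp)
  · exact hg.comp_continuousOn hu

/-- Grönwall for the squared distance of the two states; `r₀ = 0` is allowed because
`acc_sub_mul_le` is uniform in r. -/
theorem eq_of_eq_left {n a b : ℝ} (hn : 0 ≤ n) (ha : 0 < a) (hb : 0 < b) {g : ℝ → ℝ}
    (hg : LocallyLipschitz g) {r₀ r₁ : ℝ} (h0 : 0 ≤ r₀) (h01 : r₀ ≤ r₁) {u p v q : ℝ → ℝ}
    (hu : ContinuousOn u (Icc r₀ r₁)) (hp : ContinuousOn p (Icc r₀ r₁))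
    (hv : ContinuousOn v (Icc r₀ r₁)) (hq : ContinuousOn q (Icc r₀ r₁))
    (du : ∀ r ∈ Ioo r₀ r₁, HasDerivAt u (p r) r)
    (dp : ∀ r ∈ Ioo r₀ r₁, HasDerivAt p (acc n a b g r (u r) (p r)) r)
    (dv : ∀ r ∈ Ioo r₀ r₁, HasDerivAt v (q r) r)
    (dq : ∀ r ∈ Ioo r₀ r₁, HasDerivAt q (acc n a b g r (v r) (q r)) r)
    (huv : u r₀ = v r₀) (hpq : p r₀ = q r₀) : u r₁ = v r₁ ∧ p r₁ = q r₁ := by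
  obtain ⟨L, hL⟩ := (hg.locallyLipschitzOn
    (s := u '' Icc r₀ r₁ ∪ v '' Icc r₀ r₁)).exists_lipschitzOnWith_of_compact
      ((isCompact_Icc.image_of_continuousOn hu).union (isCompact_Icc.image_of_continuousOn hv))
  set k := min a b with hk
  have hk0 : 0 < k := lt_min ha hb
  have key := le_exp_of_hasDerivAt_le (E := fun r => (u r - v r) ^ 2 + (p r - q r) ^ 2)
    (E' := fun r => 2 * (u r - v r) * (p r - q r)
      + 2 * (p r - q r) * (acc n a b g r (u r) (p r) - acc n a b g r (v r) (q r)))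
    (C := 1 + k⁻¹ * L) (D := 0) h01 (by fun_prop) ?_ ?_
  · simp only [huv, hpq, sub_self, add_zero] at key
    have : (u r₁ - v r₁) ^ 2 + (p r₁ - q r₁) ^ 2 ≤ 0 := by simpa using key
    have h1 : (u r₁ - v r₁) ^ 2 = 0 := by
      nlinarith [sq_nonneg (u r₁ - v r₁), sq_nonneg (p r₁ - q r₁)]
    have h2 : (p r₁ - q r₁) ^ 2 = 0 := by
      nlinarith [sq_nonneg (u r₁ - v r₁), sq_nonneg (p r₁ - q r₁)]
    exact ⟨sub_eq_zero.mp (pow_eq_zero_iff two_ne_zero |>.mp h1),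
      sub_eq_zero.mp (pow_eq_zero_iff two_ne_zero |>.mp h2)⟩
  · intro r hr
    refine ((((du r hr).sub (dv r hr)).pow 2).add
      (((dp r hr).sub (dq r hr)).pow 2)).congr_deriv ?_
    simp
  · intro r hr
    have hr0 : 0 < r := h0.trans_lt hr.1
    have hr' : r ∈ Icc r₀ r₁ := Ioo_subset_Icc_self hr
    have h1 := acc_sub_mul_le hn hk0 (min_le_left a b) (min_le_right a b) g hr0
      (u r) (p r) (v r) (q r)
    have h2 : |g (u r) - g (v r)| ≤ L * |u r - v r| := by
      simpa [Real.dist_eq] using hL.dist_le_mul (u r) (Or.inl (mem_image_of_mem u hr')) (v r)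
        (Or.inr (mem_image_of_mem v hr'))
    have h3 : k⁻¹ * |p r - q r| * |g (u r) - g (v r)| ≤
        k⁻¹ * |p r - q r| * (L * |u r - v r|) := by gcongr
    have h4 : 2 * (|p r - q r| * |u r - v r|) ≤ (u r - v r) ^ 2 + (p r - q r) ^ 2 := by
      rw [← sq_abs (u r - v r), ← sq_abs (p r - q r)]
      nlinarith [sq_nonneg (|u r - v r| - |p r - q r|)]
    have h5 : 2 * (u r - v r) * (p r - q r) ≤ (u r - v r) ^ 2 + (p r - q r) ^ 2 := by
      nlinarith [sq_nonneg ((u r - v r) - (p r - q r))]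
    have h6 : k⁻¹ * L * (2 * (|p r - q r| * |u r - v r|)) ≤
        k⁻¹ * L * ((u r - v r) ^ 2 + (p r - q r) ^ 2) := by gcongr
    simp only [add_zero]
    nlinarith

/-- Comparison with the rest state: damping cannot increase p², so a bound on g(u) alone controls
u'. This reduces blow-up of (u, u') to blow-up of u. -/
theorem abs_deriv_le_exp {n a b k : ℝ} (hn : 0 ≤ n) (hk : 0 < k) (ha : k ≤ a) (hb : k ≤ b)
    {g : ℝ → ℝ} (hg : g 0 = 0) {r₁ C : ℝ} (h1 : 0 ≤ r₁) {u p : ℝ → ℝ}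
    (hp : ContinuousOn p (Icc 0 r₁)) (hp0 : p 0 = 0)
    (dp : ∀ r ∈ Ioo 0 r₁, HasDerivAt p (acc n a b g r (u r) (p r)) r)
    (hC : ∀ r ∈ Ioo 0 r₁, |g (u r)| ≤ C) : p r₁ ^ 2 ≤ (k⁻¹ * C) ^ 2 * Real.exp r₁ := by
  have key := le_exp_of_hasDerivAt_le (E := fun r => p r ^ 2)
    (E' := fun r => 2 * (p r * acc n a b g r (u r) (p r))) (C := 1) (D := (k⁻¹ * C) ^ 2) h1
    (by fun_prop) ?_ ?_
  · simp only [hp0] at key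
    norm_num at key
    nlinarith [sq_nonneg (k⁻¹ * C)]
  · intro r hr
    refine ((dp r hr).pow 2).congr_deriv ?_
    simp; ring
  · intro r hr
    have h1 := mul_acc_le hn hk ha hb hg hr.1 (u r) (p r)
    have h2 : k⁻¹ * |p r| * |g (u r)| ≤ k⁻¹ * |p r| * C :=
      mul_le_mul_of_nonneg_left (hC r hr) (by positivity)
    rw [← sq_abs (p r)]
    nlinarith [sq_nonneg (|p r| - k⁻¹ * C)]

/-! ### Intervals [0, R) and passage between solutions and the first order system -/

theorem zero_mem_dom {R : EReal} (hR : 0 < R) : (0 : ℝ) ∈ dom R := ⟨le_rfl, by simpa using hR⟩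

theorem dom_mono {R R' : EReal} (h : R ≤ R') : dom R ⊆ dom R' := fun _ hr => ⟨hr.1, hr.2.trans_le h⟩

theorem dom_coe (R : ℝ) : dom (R : EReal) = Ico 0 R := by
  ext r; simp [dom]

theorem dom_top : dom ⊤ = Ici 0 := by
  ext r; simp [dom, EReal.coe_lt_top]

theorem Icc_subset_dom {R : EReal} {r : ℝ} (hr : r ∈ dom R) : Icc 0 r ⊆ dom R :=
  fun _ hs => ⟨hs.1, (EReal.coe_le_coe_iff.mpr hs.2).trans_lt hr.2⟩

theorem convex_dom (R : EReal) : Convex ℝ (dom R) := by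
  refine OrdConnected.convex ⟨fun x hx y hy z hz => ⟨hx.1.trans hz.1, ?_⟩⟩
  exact (EReal.coe_le_coe_iff.mpr hz.2).trans_lt hy.2

theorem isOpen_interval (R : EReal) : IsOpen {r : ℝ | 0 < r ∧ (r : EReal) < R} :=
  (isOpen_lt continuous_const continuous_id).inter
    (isOpen_lt continuous_coe_real_ereal continuous_const)

theorem interior_dom (R : EReal) : interior (dom R) = {r : ℝ | 0 < r ∧ (r : EReal) < R} := by
  refine Subset.antisymm (fun r hr => ⟨?_, (interior_subset hr).2⟩)
    (interior_maximal (fun r hr => ⟨hr.1.le, hr.2⟩) (isOpen_interval R))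
  have : interior (dom R) ⊆ interior (Ici 0) := interior_mono fun r hr => hr.1
  simpa using this hr

theorem exists_pos_mem_dom {R : EReal} (hR : 0 < R) : ∃ r : ℝ, 0 < r ∧ (r : EReal) < R := by
  obtain ⟨r, h1, h2⟩ := EReal.lt_iff_exists_real_btwn.mp hR
  exact ⟨r, by simpa using h1, h2⟩

theorem uniqueDiffOn_dom {R : EReal} (hR : 0 < R) : UniqueDiffOn ℝ (dom R) :=
  uniqueDiffOn_convex (convex_dom R) (by rw [interior_dom]; exact exists_pos_mem_dom hR)

theorem dom_mem_nhds {R : EReal} {r : ℝ} (h0 : 0 < r) (hr : (r : EReal) < R) : dom R ∈ 𝓝 r :=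
  mem_of_superset ((isOpen_interval R).mem_nhds ⟨h0, hr⟩) fun _ hs => ⟨hs.1.le, hs.2⟩

theorem dom_mem_nhdsWithin {R R' : EReal} {r : ℝ} (hr : (r : EReal) < R) :
    dom R ∈ 𝓝[dom R'] r := by
  have : {s : ℝ | (s : EReal) < R} ∈ 𝓝 r :=
    (isOpen_lt continuous_coe_real_ereal continuous_const).mem_nhds hr
  filter_upwards [mem_nhdsWithin_of_mem_nhds this, self_mem_nhdsWithin] with s h1 h2
  exact ⟨h2.1, h1⟩

/-- `(u, p)` solves on `[0, R)` the first order system equivalent to the radial equation with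
slopes `a`, `b` in dimension `n + 1`, with `p 0 = 0`. -/
structure RadialODE (n a b : ℝ) (g : ℝ → ℝ) (R : EReal) (u p : ℝ → ℝ) : Prop where
  continuousOn_left : ContinuousOn u (dom R)
  continuousOn_right : ContinuousOn p (dom R)
  right_zero : p 0 = 0
  hasDerivAt_left : ∀ r : ℝ, 0 < r → (r : EReal) < R → HasDerivAt u (p r) r
  hasDerivAt_right : ∀ r : ℝ, 0 < r → (r : EReal) < R →
    HasDerivAt p (acc n a b g r (u r) (p r)) r

theorem RadialODE.neg {n a b : ℝ} {g : ℝ → ℝ} (hodd : ∀ s, g (-s) = -g s) {R : EReal}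
    {u p : ℝ → ℝ} (h : RadialODE n a b g R u p) :
    RadialODE n b a g R (fun r => -u r) (fun r => -p r) where
  continuousOn_left := h.continuousOn_left.neg
  continuousOn_right := h.continuousOn_right.neg
  right_zero := by simp [h.right_zero]
  hasDerivAt_left r h0 h1 := (h.hasDerivAt_left r h0 h1).neg
  hasDerivAt_right r h0 h1 := by
    rw [acc_neg hodd]
    exact (h.hasDerivAt_right r h0 h1).neg

theorem RadialODE.eqOn {n a b : ℝ} (hn : 0 ≤ n) (ha : 0 < a) (hb : 0 < b) {g : ℝ → ℝ}
    (hg : LocallyLipschitz g) {R : EReal} {u p v q : ℝ → ℝ} (hu : RadialODE n a b g R u p)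
    (hv : RadialODE n a b g R v q) (h0 : u 0 = v 0) : EqOn u v (dom R) := by
  intro r hr
  have hs := Icc_subset_dom hr
  have hs' : ∀ s ∈ Ioo 0 r, (s : EReal) < R := fun s hs' => (hs (Ioo_subset_Icc_self hs')).2
  exact (eq_of_eq_left hn ha hb hg le_rfl hr.1 (hu.continuousOn_left.mono hs)
    (hu.continuousOn_right.mono hs) (hv.continuousOn_left.mono hs) (hv.continuousOn_right.mono hs)
    (fun s h => hu.hasDerivAt_left s h.1 (hs' s h)) (fun s h => hu.hasDerivAt_right s h.1 (hs' s h))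
    (fun s h => hv.hasDerivAt_left s h.1 (hs' s h)) (fun s h => hv.hasDerivAt_right s h.1 (hs' s h))
    h0 (hu.right_zero.trans hv.right_zero.symm)).1

section

variable {N : ℕ} {a b : ℝ} {g : ℝ → ℝ} {ξ : ℝ} {R R' : EReal} {u v p : ℝ → ℝ}

theorem IsSolution.contDiffAt (hu : IsSolution N a b g ξ R u) {r : ℝ} (h0 : 0 < r)
    (hr : (r : EReal) < R) : ContDiffAt ℝ 2 u r :=
  (hu.contDiffOn r ⟨h0.le, hr⟩).contDiffAt (dom_mem_nhds h0 hr)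

/-- The velocity is taken as `derivWithin`, which is continuous up to 0; `deriv u 0` would depend on
the irrelevant values of u at negative points. The formula for u'' comes from inverting `pl`. -/
theorem IsSolution.radialODE (ha : 0 < a) (hb : 0 < b) (hu : IsSolution N a b g ξ R u) :
    RadialODE ((N : ℝ) - 1) a b g R u (derivWithin u (dom R)) where
  continuousOn_left := hu.contDiffOn.continuousOn
  continuousOn_right :=
    hu.contDiffOn.continuousOn_derivWithin (uniqueDiffOn_dom hu.pos) (by norm_num)
  right_zero := (hu.init_deriv.mono fun _ hr => hr.1).derivWithin
    (uniqueDiffOn_dom hu.pos 0 (zero_mem_dom hu.pos))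
  hasDerivAt_left r h0 hr := by
    rw [derivWithin_of_mem_nhds (dom_mem_nhds h0 hr)]
    exact ((hu.contDiffAt h0 hr).differentiableAt (by norm_num)).hasDerivAt
  hasDerivAt_right r h0 hr := by
    have hev : derivWithin u (dom R) =ᶠ[𝓝 r] deriv u := by
      filter_upwards [(isOpen_interval R).mem_nhds ⟨h0, hr⟩] with s hs
      exact derivWithin_of_mem_nhds (dom_mem_nhds hs.1 hs.2)
    have hd : DifferentiableAt ℝ (deriv u) r := by
      have h1 : ContDiffOn ℝ 2 u {r : ℝ | 0 < r ∧ (r : EReal) < R} :=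
        hu.contDiffOn.mono fun s hs => ⟨hs.1.le, hs.2⟩
      have h2 : ContDiffOn ℝ (1 + 1) u {r : ℝ | 0 < r ∧ (r : EReal) < R} := by
        convert h1 using 1; norm_num
      have h3 := ((contDiffOn_succ_iff_deriv_of_isOpen (isOpen_interval R)).mp h2).2.2
      exact (h3.differentiableOn (by norm_num)).differentiableAt
        ((isOpen_interval R).mem_nhds ⟨h0, hr⟩)
    refine (hd.hasDerivAt.congr_of_eventuallyEq hev).congr_deriv ?_
    have he := hu.eqn r h0 hr
    have h4 : pl a b (deriv (deriv u) r) = -(((N : ℝ) - 1) / r * pl a b (deriv u r)) - g (u r) := by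
      unfold pl; linarith
    rw [acc, hev.eq_of_nhds, ← h4, pl_inv_pl ha hb]

theorem contDiffOn_two_of_hasDerivAt {s : Set ℝ} (hs : IsOpen s) {u p q : ℝ → ℝ}
    (hu : ∀ r ∈ s, HasDerivAt u (p r) r) (hp : ∀ r ∈ s, HasDerivAt p (q r) r)
    (hq : ContinuousOn q s) : ContDiffOn ℝ 2 u s := by
  have h1 : ContDiffOn ℝ (0 + 1) p s := by
    refine (contDiffOn_succ_iff_deriv_of_isOpen hs).mpr
      ⟨fun r hr => (hp r hr).differentiableAt.differentiableWithinAt, by simp, ?_⟩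
    exact (contDiffOn_zero.mpr hq).congr fun r hr => (hp r hr).deriv
  have h2 : ContDiffOn ℝ (1 + 1) u s := by
    refine (contDiffOn_succ_iff_deriv_of_isOpen hs).mpr
      ⟨fun r hr => (hu r hr).differentiableAt.differentiableWithinAt, by simp, ?_⟩
    exact (by simpa using h1 : ContDiffOn ℝ 1 p s).congr fun r hr => (hu r hr).deriv
  convert h2 using 1; norm_num

/-- Gluing principle: regularity at 0 is inherited from the known solution `v`, and away from 0 it
follows from the system, as `acc` is continuous there. -/
theorem IsSolution.of_eqOn (ha : 0 < a) (hb : 0 < b) (hg : Continuous g)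
    (hv : IsSolution N a b g ξ R v) (hR : R ≤ R') (huv : EqOn u v (dom R))
    (du : ∀ r : ℝ, 0 < r → (r : EReal) < R' → HasDerivAt u (p r) r)
    (dp : ∀ r : ℝ, 0 < r → (r : EReal) < R' →
      HasDerivAt p (acc ((N : ℝ) - 1) a b g r (u r) (p r)) r) :
    IsSolution N a b g ξ R' u where
  pos := hv.pos.trans_le hR
  contDiffOn := by
    have hS : ContDiffOn ℝ 2 u {r : ℝ | 0 < r ∧ (r : EReal) < R'} := by
      refine contDiffOn_two_of_hasDerivAt (isOpen_interval R') (fun r hr => du r hr.1 hr.2)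
        (fun r hr => dp r hr.1 hr.2) (continuousOn_acc hg (fun r hr => hr.1)
        (fun r hr => (du r hr.1 hr.2).continuousAt.continuousWithinAt)
        fun r hr => (dp r hr.1 hr.2).continuousAt.continuousWithinAt)
    intro r hr
    rcases hr.1.eq_or_lt with rfl | h0
    · have h1 : ContDiffWithinAt ℝ 2 u (dom R) 0 :=
        (hv.contDiffOn 0 (zero_mem_dom hv.pos)).congr (fun s hs => huv hs)
          (huv (zero_mem_dom hv.pos))
      exact h1.mono_of_mem_nhdsWithin (dom_mem_nhdsWithin (by simpa using hv.pos))
    · exact ((hS r ⟨h0, hr.2⟩).contDiffAt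
        ((isOpen_interval R').mem_nhds ⟨h0, hr.2⟩)).contDiffWithinAt
  init := (huv (zero_mem_dom hv.pos)).trans hv.init
  init_deriv := by
    have h1 : HasDerivWithinAt u 0 (dom R) 0 :=
      (hv.init_deriv.mono fun _ hr => hr.1).congr (fun s hs => huv hs) (huv (zero_mem_dom hv.pos))
    refine h1.mono_of_mem_nhdsWithin ?_
    rw [← dom_top]
    exact dom_mem_nhdsWithin (by simpa using hv.pos)
  eqn r h0 hr := by
    have hev : deriv u =ᶠ[𝓝 r] p := by
      filter_upwards [(isOpen_interval R').mem_nhds ⟨h0, hr⟩] with s hs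
      exact (du s hs.1 hs.2).deriv
    have h2 : deriv (deriv u) r = acc ((N : ℝ) - 1) a b g r (u r) (p r) := by
      rw [hev.deriv_eq, (dp r h0 hr).deriv]
    have h3 := pl_pl_inv ha hb (-(((N : ℝ) - 1) / r * pl a b (p r)) - g (u r))
    rw [h2, hev.eq_of_nhds, acc]
    unfold pl at h3 ⊢
    linarith

theorem IsSolution.mono (hu : IsSolution N a b g ξ R u) (h0 : 0 < R') (hR : R' ≤ R) :
    IsSolution N a b g ξ R' u where
  pos := h0
  contDiffOn := hu.contDiffOn.mono (dom_mono hR)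
  init := hu.init
  init_deriv := hu.init_deriv
  eqn r h1 h2 := hu.eqn r h1 (h2.trans_le hR)

theorem IsSolution.eqOn (hN : 1 ≤ N) (ha : 0 < a) (hb : 0 < b) (hg : LocallyLipschitz g)
    (hu : IsSolution N a b g ξ R u) (hv : IsSolution N a b g ξ R' v) (hR : R ≤ R') :
    EqOn u v (dom R) := by
  have hn : (0 : ℝ) ≤ (N : ℝ) - 1 := by
    have : (1 : ℝ) ≤ N := by exact_mod_cast hN
    linarith
  exact (hu.radialODE ha hb).eqOn hn ha hb hg ((hv.mono hu.pos hR).radialODE ha hb)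
    (hu.init.trans hv.init.symm)

/-! ### Maximal solutions and continuation -/

/-- By uniqueness any two solutions agree on the shorter interval, so they glue to one on [0, sup
R). The value at r is read from some solution that lives beyond r. -/
theorem exists_isMaximalSolution_of_exists (hN : 1 ≤ N) (ha : 0 < a) (hb : 0 < b)
    (hg : LocallyLipschitz g) (hex : ∃ (R : EReal) (u : ℝ → ℝ), IsSolution N a b g ξ R u) :
    ∃ (R : EReal) (u : ℝ → ℝ), IsMaximalSolution N a b g ξ R u := by
  classical
  set S : Set EReal := {R | ∃ u, IsSolution N a b g ξ R u} with hS
  have hext : ∀ r : ℝ, ∃ P : EReal × (ℝ → ℝ), (r : EReal) < sSup S →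
      (r : EReal) < P.1 ∧ IsSolution N a b g ξ P.1 P.2 := by
    intro r
    by_cases hr : (r : EReal) < sSup S
    · obtain ⟨R, ⟨u, hu⟩, hR⟩ := lt_sSup_iff.mp hr
      exact ⟨(R, u), fun _ => ⟨hR, hu⟩⟩
    -- A dummy pair, never read, for r beyond the supremum.
    · exact ⟨(0, 0), fun h => absurd h hr⟩
  choose P hP using hext
  set w : ℝ → ℝ := fun r => (P r).2 r with hw
  have hwu : ∀ {R : EReal} {v : ℝ → ℝ}, IsSolution N a b g ξ R v → EqOn w v (dom R) := by
    intro R v hv r hr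
    have hr' : (r : EReal) < sSup S := hr.2.trans_le (le_sSup ⟨v, hv⟩)
    obtain ⟨h1, h2⟩ := hP r hr'
    rcases le_total R (P r).1 with h | h
    · exact (hv.eqOn hN ha hb hg h2 h hr).symm
    · exact h2.eqOn hN ha hb hg hv h ⟨hr.1, h1⟩
  obtain ⟨R₀, v, hv⟩ := hex
  refine ⟨sSup S, w, ?_, fun R' v' hR' _ hv' => (le_sSup (show R' ∈ S from ⟨v', hv'⟩)).not_gt hR'⟩
  have hloc : ∀ r : ℝ, 0 < r → (r : EReal) < sSup S →
      HasDerivAt w (deriv w r) r ∧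
        HasDerivAt (deriv w) (acc ((N : ℝ) - 1) a b g r (w r) (deriv w r)) r := by
    intro r h0 hr
    obtain ⟨h1, h2⟩ := hP r hr
    have hode := h2.radialODE ha hb
    have hmem := (isOpen_interval (P r).1).mem_nhds (show r ∈ _ from ⟨h0, h1⟩)
    have hd : ∀ s ∈ {s : ℝ | 0 < s ∧ (s : EReal) < (P r).1},
        HasDerivAt w (derivWithin (P r).2 (dom (P r).1) s) s := by
      intro s hs
      refine (hode.hasDerivAt_left s hs.1 hs.2).congr_of_eventuallyEq ?_
      filter_upwards [dom_mem_nhds hs.1 hs.2] with t ht using hwu h2 ht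
    have hev : deriv w =ᶠ[𝓝 r] derivWithin (P r).2 (dom (P r).1) := by
      filter_upwards [hmem] with s hs using (hd s hs).deriv
    refine ⟨(hd r ⟨h0, h1⟩).differentiableAt.hasDerivAt, ?_⟩
    rw [hev.eq_of_nhds, hwu h2 (show r ∈ dom (P r).1 from ⟨h0.le, h1⟩)]
    exact (hode.hasDerivAt_right r h0 h1).congr_of_eventuallyEq hev
  exact hv.of_eqOn ha hb hg.continuous (le_sSup ⟨v, hv⟩) (hwu hv)
    (fun r h0 hr => (hloc r h0 hr).1) fun r h0 hr => (hloc r h0 hr).2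

end

theorem exists_lipschitzOnWith_system {n a b : ℝ} (hn : 0 ≤ n) (ha : 0 < a) (hb : 0 < b)
    {g : ℝ → ℝ} (hg : LocallyLipschitz g) {ρ : ℝ} (hρ : 0 < ρ) (B : ℝ) :
    ∃ K : NNReal, ∀ r, ρ ≤ r → LipschitzOnWith K
      (fun x : ℝ × ℝ => (x.2, acc n a b g r x.1 x.2)) (Metric.closedBall 0 B) := by
  obtain ⟨L, hL⟩ := (hg.locallyLipschitzOn
    (s := Icc (-B) B)).exists_lipschitzOnWith_of_compact isCompact_Icc
  set k := min a b
  set κ := max a b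
  have hk : 0 < k := lt_min ha hb
  have hκ : 0 < κ := ha.trans_le (le_max_left a b)
  refine ⟨1 + (k⁻¹ * (n / ρ * κ + L)).toNNReal, fun r hr => LipschitzOnWith.of_dist_le_mul ?_⟩
  intro x hx y hy
  have hr0 : 0 < r := hρ.trans_le hr
  have hmem : ∀ z ∈ Metric.closedBall (0 : ℝ × ℝ) B, z.1 ∈ Icc (-B) B := by
    intro z hz
    rw [mem_closedBall_zero_iff] at hz
    exact abs_le.mp ((norm_fst_le z).trans hz)
  have h1 : |x.1 - y.1| ≤ dist x y := by rw [Prod.dist_eq]; exact le_max_left _ _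
  have h2 : |x.2 - y.2| ≤ dist x y := by rw [Prod.dist_eq]; exact le_max_right _ _
  have h3 : |g x.1 - g y.1| ≤ L * |x.1 - y.1| := by
    simpa [Real.dist_eq] using hL.dist_le_mul x.1 (hmem x hx) y.1 (hmem y hy)
  have hc0 : 0 ≤ k⁻¹ * (n / ρ * κ + L) := by positivity
  have h4 : |acc n a b g r x.1 x.2 - acc n a b g r y.1 y.2|
      ≤ k⁻¹ * (n / ρ * κ + L) * dist x y := by
    unfold acc
    refine (abs_pl_sub_le (inv_pos.mpr ha).le (inv_pos.mpr hb).le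
      (inv_anti₀ hk (min_le_left a b)) (inv_anti₀ hk (min_le_right a b)) _ _).trans ?_
    rw [mul_assoc]
    refine mul_le_mul_of_nonneg_left ?_ (inv_pos.mpr hk).le
    have h5 : |pl a b x.2 - pl a b y.2| ≤ κ * |x.2 - y.2| :=
      abs_pl_sub_le ha.le hb.le (le_max_left a b) (le_max_right a b) _ _
    calc |(-(n / r * pl a b x.2) - g x.1) - (-(n / r * pl a b y.2) - g y.1)|
        = |n / r * (pl a b x.2 - pl a b y.2) + (g x.1 - g y.1)| := by
          rw [← abs_neg]; congr 1; ring
      _ ≤ |n / r * (pl a b x.2 - pl a b y.2)| + |g x.1 - g y.1| := abs_add_le _ _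
      _ = n / r * |pl a b x.2 - pl a b y.2| + |g x.1 - g y.1| := by
          rw [abs_mul, abs_of_nonneg (by positivity : 0 ≤ n / r)]
      _ ≤ n / ρ * (κ * dist x y) + L * dist x y := by
          gcongr
          · exact h5.trans (by gcongr)
          · exact h3.trans (by gcongr)
      _ = _ := by ring
  rw [NNReal.coe_add, Real.coe_toNNReal _ hc0, Prod.dist_eq]
  refine max_le ?_ ?_
  · rw [Real.dist_eq]
    have := mul_nonneg hc0 (dist_nonneg (x := x) (y := y))
    simp only [NNReal.coe_one]
    linarith
  · rw [Real.dist_eq]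
    have := dist_nonneg (x := x) (y := y)
    simp only [NNReal.coe_one]
    linarith

/-- Away from r = 0 the system is Lipschitz on bounded sets uniformly in r, so Picard–Lindelöf gives
a lifespan depending only on `ρ` and `B`. -/
theorem exists_solution_uniform_time {n a b : ℝ} (hn : 0 ≤ n) (ha : 0 < a) (hb : 0 < b)
    {g : ℝ → ℝ} (hg : LocallyLipschitz g) (hg0 : g 0 = 0) {ρ B : ℝ} (hρ : 0 < ρ) (hB : 0 ≤ B) :
    ∃ T : ℝ, 0 < T ∧ ∀ r₀ u₀ p₀ : ℝ, ρ ≤ r₀ → |u₀| ≤ B → |p₀| ≤ B →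
      ∃ v q : ℝ → ℝ, v r₀ = u₀ ∧ q r₀ = p₀ ∧
        ContinuousOn v (Icc r₀ (r₀ + T)) ∧ ContinuousOn q (Icc r₀ (r₀ + T)) ∧
        (∀ r ∈ Ioo r₀ (r₀ + T), HasDerivAt v (q r) r) ∧
        ∀ r ∈ Ioo r₀ (r₀ + T), HasDerivAt q (acc n a b g r (v r) (q r)) r := by
  obtain ⟨K, hK⟩ := exists_lipschitzOnWith_system hn ha hb hg hρ (B + 1)
  set L : NNReal := K * (B + 1).toNNReal with hL
  have hB1 : ((B + 1).toNNReal : ℝ) = B + 1 := Real.coe_toNNReal _ (by linarith)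
  -- `L` bounds the speed on the ball of radius B + 1, so within this time a trajectory moves by at
  -- most 1 and stays there.
  refine ⟨((L : ℝ) + 1)⁻¹, by positivity, fun r₀ u₀ p₀ hr₀ hu₀ hp₀ => ?_⟩
  set T : ℝ := ((L : ℝ) + 1)⁻¹ with hT
  have hT0 : 0 < T := by positivity
  have hball : Metric.closedBall (u₀, p₀) ((1 : NNReal) : ℝ) ⊆
      Metric.closedBall (0 : ℝ × ℝ) (B + 1) := by
    refine Metric.closedBall_subset_closedBall' ?_
    rw [dist_zero_right, NNReal.coe_one, add_comm]
    exact add_le_add_left (max_le hu₀ hp₀) 1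
  have hPL : IsPicardLindelof (fun r (x : ℝ × ℝ) => (x.2, acc n a b g r x.1 x.2))
      (tmin := r₀) (tmax := r₀ + T) ⟨r₀, left_mem_Icc.mpr (by linarith)⟩ (u₀, p₀) 1 0 L K := by
    refine ⟨fun t ht => (hK t (hr₀.trans ht.1)).mono hball, fun x _ => ?_, fun t ht x hx => ?_, ?_⟩
    · exact continuousOn_const.prodMk (continuousOn_acc hg.continuous
        (fun r hr => hρ.trans_le (hr₀.trans hr.1)) continuousOn_const continuousOn_const)
    · have hx' := hball hx
      have h0 : (0 : ℝ × ℝ) ∈ Metric.closedBall (0 : ℝ × ℝ) (B + 1) :=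
        Metric.mem_closedBall_self (by linarith)
      have h1 := (hK t (hr₀.trans ht.1)).dist_le_mul x hx' 0 h0
      have h2 : ((0 : ℝ × ℝ).2, acc n a b g t (0 : ℝ × ℝ).1 (0 : ℝ × ℝ).2) = (0 : ℝ × ℝ) := by
        simp [acc, hg0]
      rw [h2, dist_zero_right, dist_zero_right] at h1
      rw [mem_closedBall_zero_iff] at hx'
      rw [hL, NNReal.coe_mul, hB1]
      exact h1.trans (mul_le_mul_of_nonneg_left hx' K.2)
    · simp only [add_sub_cancel_left, sub_self, NNReal.coe_one, NNReal.coe_zero, sub_zero]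
      rw [max_eq_left hT0.le, hT, ← div_eq_mul_inv, div_le_one (by positivity)]
      linarith
  obtain ⟨γ, hγ0, hγ⟩ := hPL.exists_eq_forall_mem_Icc_hasDerivWithinAt₀
  refine ⟨fun r => (γ r).1, fun r => (γ r).2, by simp [hγ0], by simp [hγ0], ?_, ?_, ?_, ?_⟩
  · exact fun r hr => (hγ r hr).continuousWithinAt.fst
  · exact fun r hr => (hγ r hr).continuousWithinAt.snd
  · intro r hr
    exact ((hγ r (Ioo_subset_Icc_self hr)).hasDerivAt (Icc_mem_nhds hr.1 hr.2)).fst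
  · intro r hr
    exact ((hγ r (Ioo_subset_Icc_self hr)).hasDerivAt (Icc_mem_nhds hr.1 hr.2)).snd

/-- If R were finite, u' would be bounded too, and restarting close enough to R with the uniform
lifespan would extend the solution past R. -/
theorem IsMaximalSolution.eq_top_of_bounded {N : ℕ} (hN : 1 ≤ N) {a b : ℝ} (ha : 0 < a)
    (hb : 0 < b) {g : ℝ → ℝ} (hg : LocallyLipschitz g) (hg0 : g 0 = 0) {ξ : ℝ} {R : EReal}
    {u : ℝ → ℝ} (h : IsMaximalSolution N a b g ξ R u) {M : ℝ} (hM : ∀ r ∈ dom R, |u r| ≤ M) :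
    R = ⊤ := by
  by_contra hR
  obtain ⟨hu, hmax⟩ := h
  have hn : (0 : ℝ) ≤ (N : ℝ) - 1 := by
    have : (1 : ℝ) ≤ N := by exact_mod_cast hN
    linarith
  have hpos := hu.pos
  lift R to ℝ using ⟨hR, (EReal.bot_lt_zero.trans hpos).ne'⟩ with ρ
  have hρ : 0 < ρ := by simpa using hpos
  have hode := hu.radialODE ha hb
  set p := derivWithin u (dom ρ) with hp
  obtain ⟨C, hC⟩ := (isCompact_Icc (a := -M) (b := M)).exists_bound_of_continuousOn
    hg.continuous.continuousOn
  set k := min a b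
  have hk : 0 < k := lt_min ha hb
  set P : ℝ := Real.sqrt ((k⁻¹ * C) ^ 2 * Real.exp ρ) with hP
  have hpP : ∀ r ∈ dom (ρ : EReal), |p r| ≤ P := by
    intro r hr
    have hs := Icc_subset_dom hr
    have := abs_deriv_le_exp hn hk (min_le_left a b) (min_le_right a b) hg0 hr.1 (u := u) (C := C)
      (hode.continuousOn_right.mono hs) hode.right_zero
      (fun s h => hode.hasDerivAt_right s h.1 (hs (Ioo_subset_Icc_self h)).2)
      fun s h => hC _ (abs_le.mp (hM s (hs (Ioo_subset_Icc_self h))))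
    refine Real.abs_le_sqrt (this.trans ?_)
    have : r ≤ ρ := by rw [dom_coe] at hr; exact hr.2.le
    gcongr
  obtain ⟨T, hT, hloc⟩ := exists_solution_uniform_time hn ha hb hg hg0 (half_pos hρ)
    (le_max_of_le_right (Real.sqrt_nonneg _) : 0 ≤ max M P)
  -- At least ρ / 2, to keep clear of the singularity, and within T / 2 of ρ, so that the new piece
  -- reaches beyond ρ.
  set r₀ := max (ρ / 2) (ρ - T / 2) with hr₀
  have hr₀1 : ρ / 2 ≤ r₀ := le_max_left _ _
  have hr₀2 : ρ - T / 2 ≤ r₀ := le_max_right _ _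
  have hr₀3 : r₀ < ρ := max_lt (by linarith) (by linarith)
  have hr₀4 : ρ < r₀ + T := by linarith
  have hr₀mem : r₀ ∈ dom (ρ : EReal) := by rw [dom_coe]; exact ⟨by linarith, hr₀3⟩
  obtain ⟨v, q, hv0, hq0, hvc, hqc, dv, dq⟩ := hloc r₀ (u r₀) (p r₀) hr₀1
    ((hM r₀ hr₀mem).trans (le_max_left _ _)) ((hpP r₀ hr₀mem).trans (le_max_right _ _))
  have hagree : ∀ r, r₀ ≤ r → r < ρ → u r = v r ∧ p r = q r := by
    intro r h1 h2
    have hs : Icc r₀ r ⊆ dom (ρ : EReal) := fun s hs => by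
      rw [dom_coe]; exact ⟨by linarith [hs.1], by linarith [hs.2]⟩
    have hs2 : Icc r₀ r ⊆ Icc r₀ (r₀ + T) := Icc_subset_Icc_right (by linarith)
    have hs3 : Ioo r₀ r ⊆ Ioo r₀ (r₀ + T) := Ioo_subset_Ioo_right (by linarith)
    exact eq_of_eq_left hn ha hb hg (by linarith) h1 (hode.continuousOn_left.mono hs)
      (hode.continuousOn_right.mono hs) (hvc.mono hs2) (hqc.mono hs2)
      (fun s h => hode.hasDerivAt_left s (by linarith [h.1]) (hs (Ioo_subset_Icc_self h)).2)
      (fun s h => hode.hasDerivAt_right s (by linarith [h.1]) (hs (Ioo_subset_Icc_self h)).2)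
      (fun s h => dv s (hs3 h)) (fun s h => dq s (hs3 h)) hv0.symm hq0.symm
  set w : ℝ → ℝ := fun r => if r < ρ then u r else v r with hw
  set w' : ℝ → ℝ := fun r => if r < ρ then p r else q r with hw'
  have hwv : ∀ r, r₀ < r → w r = v r ∧ w' r = q r := by
    intro r hr
    by_cases h : r < ρ
    · simpa [hw, hw', h] using hagree r hr.le h
    · simp [hw, hw', h]
  have hder : ∀ r : ℝ, 0 < r → (r : EReal) < ((r₀ + T : ℝ) : EReal) →
      HasDerivAt w (w' r) r ∧ HasDerivAt w' (acc ((N : ℝ) - 1) a b g r (w r) (w' r)) r := by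
    intro r h0 h1
    rw [EReal.coe_lt_coe_iff] at h1
    by_cases h : r < ρ
    · have e1 : w =ᶠ[𝓝 r] u := by
        filter_upwards [Iio_mem_nhds h] with s hs using if_pos hs
      have e2 : w' =ᶠ[𝓝 r] p := by
        filter_upwards [Iio_mem_nhds h] with s hs using if_pos hs
      rw [e1.eq_of_nhds, e2.eq_of_nhds]
      exact ⟨(hode.hasDerivAt_left r h0 (by exact_mod_cast h)).congr_of_eventuallyEq e1,
        (hode.hasDerivAt_right r h0 (by exact_mod_cast h)).congr_of_eventuallyEq e2⟩
    · have hr : r₀ < r := by linarith [not_lt.mp h]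
      have e1 : w =ᶠ[𝓝 r] v := by
        filter_upwards [Ioi_mem_nhds hr] with s hs using (hwv s hs).1
      have e2 : w' =ᶠ[𝓝 r] q := by
        filter_upwards [Ioi_mem_nhds hr] with s hs using (hwv s hs).2
      rw [e1.eq_of_nhds, e2.eq_of_nhds]
      exact ⟨(dv r ⟨hr, h1⟩).congr_of_eventuallyEq e1, (dq r ⟨hr, h1⟩).congr_of_eventuallyEq e2⟩
  have hwu : EqOn w u (dom (ρ : EReal)) := by
    intro r hr
    rw [dom_coe] at hr
    exact if_pos hr.2
  have hlt : (ρ : EReal) < ((r₀ + T : ℝ) : EReal) := by exact_mod_cast hr₀4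
  exact hmax _ w hlt hwu (hu.of_eqOn ha hb hg.continuous hlt.le hwu
    (fun r h0 h1 => (hder r h0 h1).1) fun r h0 h1 => (hder r h0 h1).2)

/-! ### Local existence at the singular point -/

/-- The weighted average `∫₀¹ τⁿ f (s τ) dτ`. -/
noncomputable def avg (n : ℕ) (f : ℝ → ℝ) (s : ℝ) : ℝ := ∫ τ in (0 : ℝ)..1, τ ^ n * f (s * τ)

theorem continuous_avg (n : ℕ) {f : ℝ → ℝ} (hf : Continuous f) : Continuous (avg n f) := by
  unfold avg
  apply intervalIntegral.continuous_parametric_intervalIntegral_of_continuous'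
  fun_prop

theorem abs_avg_le (n : ℕ) {f : ℝ → ℝ} {C : ℝ} (hC : ∀ x, |f x| ≤ C) (s : ℝ) :
    |avg n f s| ≤ C := by
  have h := intervalIntegral.norm_integral_le_of_norm_le_const (a := (0 : ℝ)) (b := 1) (C := C)
    (f := fun τ => τ ^ n * f (s * τ)) (fun τ hτ => ?_)
  · simpa [avg] using h
  · rw [uIoc_of_le zero_le_one] at hτ
    rw [Real.norm_eq_abs, abs_mul, abs_of_nonneg (pow_nonneg hτ.1.le n)]
    calc τ ^ n * |f (s * τ)| ≤ 1 * |f (s * τ)| :=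
          mul_le_mul_of_nonneg_right (pow_le_one₀ hτ.1.le hτ.2) (abs_nonneg _)
      _ ≤ C := by rw [one_mul]; exact hC _

theorem avg_sub (n : ℕ) {f f' : ℝ → ℝ} (hf : Continuous f) (hf' : Continuous f') (s : ℝ) :
    avg n (fun x => f x - f' x) s = avg n f s - avg n f' s := by
  unfold avg
  rw [← intervalIntegral.integral_sub (Continuous.intervalIntegrable (by fun_prop) _ _)
    (Continuous.intervalIntegrable (by fun_prop) _ _)]
  congr 1
  ext τ
  ring

theorem avg_zero (n : ℕ) (f : ℝ → ℝ) : avg n f 0 = f 0 / (n + 1) := by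
  simp [avg, integral_pow]
  ring

/-- For s ≠ 0, s · avg is s⁻ⁿ ∫₀ˢ tⁿ f, the solution of (sⁿ v)' = sⁿ f. The averaged form removes
the singularity: at 0 the difference quotient is `avg` itself. -/
theorem hasDerivAt_mul_avg (n : ℕ) {f : ℝ → ℝ} (hf : Continuous f) (s : ℝ) :
    HasDerivAt (fun s => s * avg n f s) (f s - n * avg n f s) s := by
  by_cases hs : s = 0
  · subst hs
    rw [hasDerivAt_iff_tendsto_slope]
    have h0 : f 0 - n * avg n f 0 = avg n f 0 := by
      rw [avg_zero]; field_simp; ring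
    rw [h0]
    refine ((continuous_avg n hf).tendsto 0).mono_left nhdsWithin_le_nhds |>.congr' ?_
    filter_upwards [self_mem_nhdsWithin] with x hx
    have hx' : x ≠ 0 := hx
    simp [slope_def_field, hx']
  · have hI : ∀ x, x ^ n * (x * avg n f x) = ∫ t in (0 : ℝ)..x, t ^ n * f t := by
      intro x
      have := intervalIntegral.smul_integral_comp_mul_left (a := 0) (b := 1)
        (fun t => t ^ n * f t) x
      simp only [mul_zero, mul_one, smul_eq_mul] at this
      rw [← this, avg, mul_left_comm, ← intervalIntegral.integral_const_mul]
      congr 2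
      ext τ
      ring
    have hd : HasDerivAt (fun x => ∫ t in (0 : ℝ)..x, t ^ n * f t) (s ^ n * f s) s := by
      have hc : Continuous fun t => t ^ n * f t := by fun_prop
      exact hc.integral_hasStrictDerivAt 0 s |>.hasDerivAt
    have hsn : s ^ n ≠ 0 := pow_ne_zero n hs
    have hq := hd.div (hasDerivAt_pow n s) hsn
    have hn : (n : ℝ) * s ^ (n - 1) * s = n * s ^ n := by
      cases n with
      | zero => simp
      | succ m => simp [pow_succ]; ring
    refine (hq.congr_of_eventuallyEq ?_).congr_deriv ?_
    · filter_upwards [isOpen_ne.mem_nhds hs] with x hx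
      have hx' : x ^ n ≠ 0 := pow_ne_zero n hx
      rw [Pi.div_apply, ← hI x]
      field_simp
    · rw [← hI s, div_eq_iff (by positivity)]
      linear_combination (- s ^ n * avg n f s) * hn

/-- Banach's fixed point theorem on bounded continuous functions on ℝ, after freezing the upper
limit of integration outside [0, δ]. -/
theorem exists_integral_equation (n : ℕ) {g : ℝ → ℝ} {L : NNReal} (hg : LipschitzWith L g)
    {C : ℝ} (hC : ∀ x, |g x| ≤ C) (ξ c : ℝ) :
    ∃ (δ : ℝ) (u : ℝ → ℝ), 0 < δ ∧ Continuous u ∧ ∀ r ∈ Icc 0 δ,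
      u r = ξ - c * ∫ s in (0 : ℝ)..r, s * avg n (fun x => g (u x)) s := by
  -- The bound 1 absorbs the factor s in the integrand; the other makes the contraction constant
  -- 1/2.
  set δ : ℝ := min 1 (2 * (|c| * L + 1))⁻¹ with hδ
  have hδ0 : 0 < δ := by positivity
  have hδ1 : δ ≤ 1 := min_le_left _ _
  have hδL : |c| * L * δ ≤ 1 / 2 := by
    have h1 : δ ≤ (2 * (|c| * L + 1))⁻¹ := min_le_right _ _
    have h2 : 0 ≤ |c| * L := by positivity
    calc |c| * L * δ ≤ |c| * L * (2 * (|c| * L + 1))⁻¹ := by gcongr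
      _ = (|c| * L) / (|c| * L + 1) * (1 / 2) := by rw [mul_inv]; ring
      _ ≤ 1 * (1 / 2) := by
        gcongr
        rw [div_le_one (by positivity)]
        linarith
      _ = 1 / 2 := one_mul _
  set cl : ℝ → ℝ := fun r => max 0 (min r δ) with hcl
  have hcl0 : ∀ r, 0 ≤ cl r := fun r => le_max_left _ _
  have hcl1 : ∀ r, cl r ≤ δ := fun r => max_le hδ0.le (min_le_right _ _)
  have hclc : Continuous cl := by fun_prop
  have hint : ∀ (f : ℝ → ℝ) (D : ℝ), (∀ x, |f x| ≤ D) → ∀ r,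
      |∫ s in (0 : ℝ)..cl r, s * avg n f s| ≤ D * δ := by
    intro f D hD r
    have hD0 : 0 ≤ D := (abs_nonneg _).trans (hD 0)
    have h := intervalIntegral.norm_integral_le_of_norm_le_const (a := (0 : ℝ)) (b := cl r)
      (C := D) (f := fun s => s * avg n f s) (fun s hs => ?_)
    · rw [sub_zero, abs_of_nonneg (hcl0 r), Real.norm_eq_abs] at h
      exact h.trans (mul_le_mul_of_nonneg_left (hcl1 r) hD0)
    · rw [uIoc_of_le (hcl0 r)] at hs
      rw [Real.norm_eq_abs, abs_mul, abs_of_nonneg hs.1.le]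
      have h1 : s ≤ 1 := hs.2.trans ((hcl1 r).trans hδ1)
      calc s * |avg n f s| ≤ 1 * D := by
            gcongr
            exact abs_avg_le n hD s
        _ = D := one_mul D
  have hgc : ∀ u : ℝ →ᵇ ℝ, Continuous fun x => g (u x) := fun u => hg.continuous.comp u.continuous
  have hsc : ∀ u : ℝ →ᵇ ℝ, Continuous fun s => s * avg n (fun x => g (u x)) s :=
    fun u => continuous_id.mul (continuous_avg n (hgc u))
  let T : (ℝ →ᵇ ℝ) → (ℝ →ᵇ ℝ) := fun u => BoundedContinuousFunction.ofNormedAddCommGroup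
    (fun r => ξ - c * ∫ s in (0 : ℝ)..cl r, s * avg n (fun x => g (u x)) s)
    (continuous_const.sub (continuous_const.mul
      ((intervalIntegral.continuous_primitive (fun _ _ => (hsc u).intervalIntegrable _ _) 0).comp
        hclc)))
    (|ξ| + |c| * (C * δ)) (fun r => by
      rw [Real.norm_eq_abs]
      refine (abs_sub _ _).trans ?_
      rw [abs_mul]
      gcongr
      exact hint _ C (fun x => hC _) r)
  have hT : ContractingWith (1 / 2 : NNReal) T := by
    refine ⟨by rw [← NNReal.coe_lt_coe]; norm_num, LipschitzWith.of_dist_le_mul fun u v => ?_⟩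
    rw [BoundedContinuousFunction.dist_le (by positivity)]
    intro r
    have h1 : T u r - T v r =
        -c * ∫ s in (0 : ℝ)..cl r, s * avg n (fun x => g (u x) - g (v x)) s := by
      have h2 : (∫ s in (0 : ℝ)..cl r, s * avg n (fun x => g (u x) - g (v x)) s) =
          (∫ s in (0 : ℝ)..cl r, s * avg n (fun x => g (u x)) s) -
            ∫ s in (0 : ℝ)..cl r, s * avg n (fun x => g (v x)) s := by
        rw [← intervalIntegral.integral_sub ((hsc u).intervalIntegrable _ _)
          ((hsc v).intervalIntegrable _ _)]
        congr 1
        ext s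
        rw [avg_sub n (hgc u) (hgc v)]
        ring
      rw [h2]
      simp only [T, BoundedContinuousFunction.coe_ofNormedAddCommGroup]
      ring
    rw [Real.dist_eq, h1, abs_mul, abs_neg]
    have h3 := hint (fun x => g (u x) - g (v x)) (L * dist u v) (fun x => by
      have := hg.dist_le_mul (u x) (v x)
      rw [Real.dist_eq] at this
      exact this.trans (by gcongr; exact BoundedContinuousFunction.dist_coe_le_dist x)) r
    have h4 : (0 : ℝ) ≤ dist u v := dist_nonneg
    calc _ ≤ |c| * (L * dist u v * δ) := by gcongr
      _ = |c| * L * δ * dist u v := by ring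
      _ ≤ 1 / 2 * dist u v := by gcongr
      _ = _ := by simp
  obtain ⟨u, hfix⟩ : ∃ u, T u = u := ⟨_, hT.fixedPoint_isFixedPt⟩
  refine ⟨δ, u, hδ0, u.continuous, fun r hr => ?_⟩
  have hclr : cl r = r := by
    simp [hcl, min_eq_left hr.2, max_eq_right hr.1]
  conv_lhs => rw [← hfix]
  simp only [T, BoundedContinuousFunction.coe_ofNormedAddCommGroup, hclr]

/-- If g(ξ) ≠ 0, solve the problem with both coefficients frozen at the one selected by arguments of
sign opposite to g(ξ), then check that u' and u'' do have that sign for small r > 0. If g(ξ) = 0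
that sign is undetermined, but the constant is a solution. -/
theorem exists_isSolution {N : ℕ} (hN : 1 ≤ N) {a b : ℝ} (ha : 0 < a) (hb : 0 < b) {g : ℝ → ℝ}
    (hg : LocallyLipschitz g) (ξ : ℝ) :
    ∃ (R : EReal) (u : ℝ → ℝ), IsSolution N a b g ξ R u := by
  rcases eq_or_ne (g ξ) 0 with hξ | hξ
  · refine ⟨⊤, fun _ => ξ, ?_, contDiffOn_const, rfl, hasDerivWithinAt_const _ _ _, ?_⟩
    · exact EReal.coe_lt_top 0
    · intro r _ _
      simp [hξ]
  obtain ⟨n, rfl⟩ : ∃ n, N = n + 1 := ⟨N - 1, by omega⟩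
  obtain ⟨c, hc, hcoef⟩ : ∃ c : ℝ, 0 < c ∧ ∀ x, g ξ * x < 0 → coeffMinus a b x = c := by
    rcases lt_or_gt_of_ne hξ with h | h
    · refine ⟨a, ha, fun x hx => if_pos ?_⟩
      by_contra hx'
      nlinarith [mul_pos_of_neg_of_neg h (not_le.mp hx')]
    · refine ⟨b, hb, fun x hx => if_neg fun hx' => ?_⟩
      nlinarith [mul_nonneg h.le hx']
  obtain ⟨L, hL⟩ := (hg.locallyLipschitzOn
    (s := Icc (ξ - 1) (ξ + 1))).exists_lipschitzOnWith_of_compact isCompact_Icc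
  obtain ⟨C, hC⟩ := (isCompact_Icc (a := ξ - 1) (b := ξ + 1)).exists_bound_of_continuousOn
    hg.continuous.continuousOn
  -- Truncation makes g globally Lipschitz and bounded; it is invisible while u stays within 1 of ξ.
  set cl : ℝ → ℝ := fun x => max (ξ - 1) (min x (ξ + 1)) with hcl
  have hclmem : ∀ x, cl x ∈ Icc (ξ - 1) (ξ + 1) := fun x =>
    ⟨le_max_left _ _, max_le (by linarith) (min_le_right _ _)⟩
  have hclx : ∀ x, |x - ξ| < 1 → cl x = x := by
    intro x hx
    rw [abs_lt] at hx
    simp only [hcl]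
    rw [min_eq_left (by linarith), max_eq_right (by linarith)]
  have hclL : LipschitzWith 1 cl :=
    (LipschitzWith.id.min_const (ξ + 1)).const_max (ξ - 1)
  have hgL : LipschitzWith (L * 1) (g ∘ cl) :=
    lipschitzOnWith_univ.mp (hL.comp hclL.lipschitzOnWith fun x _ => hclmem x)
  obtain ⟨δ, u, hδ, huc, hu⟩ := exists_integral_equation n hgL (fun x => hC _ (hclmem x)) ξ c⁻¹
  set f : ℝ → ℝ := fun x => (g ∘ cl) (u x) with hf
  have hfc : Continuous f := hgL.continuous.comp huc
  have hac := continuous_avg n hfc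
  -- `u` satisfies the integral equation only on [0, δ]; the right-hand side `w` is C² on all of ℝ.
  set w : ℝ → ℝ := fun r => ξ - c⁻¹ * ∫ s in (0 : ℝ)..r, s * avg n f s with hw
  have dw : ∀ r, HasDerivAt w (-(c⁻¹ * (r * avg n f r))) r := by
    intro r
    have hc1 : Continuous fun s => s * avg n f s := continuous_id.mul hac
    exact (((hc1.integral_hasStrictDerivAt 0 r).hasDerivAt).const_mul c⁻¹).const_sub ξ
  have dw' : ∀ r, HasDerivAt (fun r => -(c⁻¹ * (r * avg n f r)))
      (-(c⁻¹ * (f r - n * avg n f r))) r := fun r =>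
    ((hasDerivAt_mul_avg n hfc r).const_mul c⁻¹).neg
  have hu0 : u 0 = ξ := by simpa using hu 0 ⟨le_rfl, hδ.le⟩
  have hf0 : f 0 = g ξ := by
    simp [hf, hu0, hclx]
  have hξ2 : 0 < g ξ * g ξ := mul_self_pos.mpr hξ
  have ev1 : ∀ᶠ r in 𝓝 (0 : ℝ), |u r - ξ| < 1 := by
    have : ContinuousAt (fun r => |u r - ξ|) 0 := by fun_prop
    exact this.eventually_lt continuousAt_const (by simp [hu0])
  -- This quantity governs the sign of u', and the next one that of u''. Both equal g(ξ)² / (n + 1)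
  -- at 0, so they stay positive nearby.
  have ev2 : ∀ᶠ r in 𝓝 (0 : ℝ), 0 < g ξ * avg n f r := by
    have : ContinuousAt (fun r => g ξ * avg n f r) 0 := by fun_prop
    refine continuousAt_const.eventually_lt this ?_
    rw [avg_zero, hf0, ← mul_div_assoc]
    positivity
  have ev3 : ∀ᶠ r in 𝓝 (0 : ℝ), 0 < g ξ * (f r - n * avg n f r) := by
    have : ContinuousAt (fun r => g ξ * (f r - n * avg n f r)) 0 := by fun_prop
    refine continuousAt_const.eventually_lt this ?_
    have : g ξ * (f 0 - n * avg n f 0) = g ξ * g ξ / (n + 1) := by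
      rw [avg_zero, hf0]; field_simp; ring
    rw [this]
    positivity
  obtain ⟨ε, hε, hball⟩ := Metric.eventually_nhds_iff.mp (ev1.and (ev2.and ev3))
  have hmem : ∀ r : ℝ, 0 < r → (r : EReal) < ((min δ ε : ℝ) : EReal) → r ≤ δ ∧ dist r 0 < ε := by
    intro r h0 hr
    rw [EReal.coe_lt_coe_iff, lt_min_iff] at hr
    exact ⟨hr.1.le, by rw [Real.dist_eq, sub_zero, abs_of_pos h0]; exact hr.2⟩
  refine ⟨((min δ ε : ℝ) : EReal), w, ?_, ?_, ?_, ?_, ?_⟩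
  · exact_mod_cast lt_min hδ hε
  · refine ContDiffOn.mono ?_ (subset_univ _)
    exact contDiffOn_two_of_hasDerivAt isOpen_univ (fun r _ => dw r) (fun r _ => dw' r)
      (Continuous.continuousOn (by fun_prop))
  · simp [hw]
  · simpa using (dw 0).hasDerivWithinAt (s := Ici 0)
  · intro r h0 hr
    obtain ⟨hrδ, hrε⟩ := hmem r h0 hr
    obtain ⟨h1, h2, h3⟩ := hball hrε
    have e1 : deriv w = fun r => -(c⁻¹ * (r * avg n f r)) := funext fun r => (dw r).deriv
    have e2 : deriv (deriv w) r = -(c⁻¹ * (f r - n * avg n f r)) := by rw [e1]; exact (dw' r).deriv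
    have e3 : g (w r) = f r := by
      have : w r = u r := (hu r ⟨h0.le, hrδ⟩).symm
      rw [this]
      simp only [hf, Function.comp, hclx _ h1]
    have hci : 0 < c⁻¹ := inv_pos.mpr hc
    rw [e2, e1, e3, hcoef _ (by nlinarith [mul_pos hci h3]),
      hcoef _ (by nlinarith [mul_pos (mul_pos hci h0) h2])]
    push_cast
    field_simp
    ring

/-! ### Potential, force, energy and energy barriers -/

theorem hasDerivAt_potential {g : ℝ → ℝ} (hg : Continuous g) (x : ℝ) :
    HasDerivAt (potential g) (g x) x :=
  (hg.integral_hasStrictDerivAt 0 x).hasDerivAt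

theorem continuous_potential {g : ℝ → ℝ} (hg : Continuous g) : Continuous (potential g) :=
  continuous_iff_continuousAt.mpr fun x => (hasDerivAt_potential hg x).continuousAt

@[simp] theorem potential_zero (g : ℝ → ℝ) : potential g 0 = 0 := by simp [potential]

theorem potential_sub {g : ℝ → ℝ} (hg : Continuous g) (x y : ℝ) :
    potential g y - potential g x = ∫ s in x..y, g s :=
  intervalIntegral.integral_interval_sub_left (hg.intervalIntegrable _ _)
    (hg.intervalIntegrable _ _)

theorem potential_lt {g : ℝ → ℝ} (hg : Continuous g) {x y : ℝ} (hxy : x < y)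
    (h : ∀ s ∈ Ioo x y, 0 < g s) : potential g x < potential g y := by
  rw [← sub_pos, potential_sub hg]
  exact intervalIntegral.intervalIntegral_pos_of_pos_on (hg.intervalIntegrable _ _) h hxy

theorem potential_const_mul (c : ℝ) (g : ℝ → ℝ) (x : ℝ) :
    potential (fun s => c * g s) x = c * potential g x := by
  simp [potential]

theorem potential_neg {g : ℝ → ℝ} (x : ℝ) :
    potential (fun s => g (-s)) x = -potential g (-x) := by
  unfold potential
  rw [intervalIntegral.integral_comp_neg, neg_zero, intervalIntegral.integral_symm]

theorem potential_even {g : ℝ → ℝ} (hodd : ∀ s, g (-s) = -g s) (x : ℝ) :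
    potential g (-x) = potential g x := by
  have h := potential_neg (g := g) x
  have h2 : potential (fun s => g (-s)) x = -potential g x := by
    simp [potential, hodd]
  linarith

theorem potential_gt {g : ℝ → ℝ} (hg : Continuous g) {x y : ℝ} (hxy : x < y)
    (h : ∀ s ∈ Ioo x y, g s < 0) : potential g y < potential g x := by
  have := potential_lt (g := fun s => -1 * g s) (by fun_prop) hxy fun s hs => by
    linarith [h s hs]
  rw [potential_const_mul, potential_const_mul] at this
  linarith

theorem potential_pos {g : ℝ → ℝ} (hg : Continuous g) {B x : ℝ}
    (h : ∀ s, s ≠ 0 → |s| ≤ B → 0 < s * g s) (hx : x ≠ 0) (hxB : |x| ≤ B) :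
    0 < potential g x := by
  rcases lt_or_gt_of_ne hx with hx | hx
  · rw [← potential_zero g]
    refine potential_gt hg hx fun s hs => ?_
    have := h s hs.2.ne (by rw [abs_of_neg hs.2]; rw [abs_of_neg hx] at hxB; linarith [hs.1])
    by_contra h'
    exact this.not_ge (mul_nonpos_of_nonpos_of_nonneg hs.2.le (not_lt.mp h'))
  · rw [← potential_zero g]
    refine potential_lt hg hx fun s hs => ?_
    have := h s hs.1.ne' (by rw [abs_of_pos hs.1]; rw [abs_of_pos hx] at hxB; linarith [hs.2])
    exact (pos_iff_pos_of_mul_pos this).mp hs.1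

/-- The opposite of the acceleration at rest. -/
noncomputable def force (a b : ℝ) (g : ℝ → ℝ) (s : ℝ) : ℝ := pl b⁻¹ a⁻¹ (g s)

theorem continuous_force {a b : ℝ} {g : ℝ → ℝ} (hg : Continuous g) : Continuous (force a b g) :=
  (continuous_pl _ _).comp hg

theorem acc_zero_right (n a b : ℝ) (g : ℝ → ℝ) (r u : ℝ) :
    acc n a b g r u 0 = -force a b g u := by
  simp [acc, force, pl_neg]

theorem force_pos {a b : ℝ} (hb : 0 < b) {g : ℝ → ℝ} {s : ℝ} (h : 0 < g s) :
    0 < force a b g s := pl_pos (inv_pos.mpr hb) h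

theorem force_neg {a b : ℝ} (ha : 0 < a) {g : ℝ → ℝ} {s : ℝ} (h : g s < 0) :
    force a b g s < 0 := by
  rw [force, pl_of_nonpos h.le]
  exact mul_neg_of_pos_of_neg (inv_pos.mpr ha) h

theorem mul_force_pos {a b : ℝ} (ha : 0 < a) (hb : 0 < b) {g : ℝ → ℝ} {s : ℝ} (h : 0 < s * g s) :
    0 < s * force a b g s := by
  rcases pos_and_pos_or_neg_and_neg_of_mul_pos h with h | h
  · exact mul_pos h.1 (force_pos hb h.2)
  · exact mul_pos_of_neg_of_neg h.1 (force_neg ha h.2)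

theorem potential_force_of_nonneg {a b : ℝ} {g : ℝ → ℝ} {x : ℝ} (hx : 0 ≤ x)
    (h : ∀ s ∈ Icc 0 x, 0 ≤ g s) : potential (force a b g) x = b⁻¹ * potential g x := by
  rw [← potential_const_mul]
  refine intervalIntegral.integral_congr fun s hs => ?_
  rw [uIcc_of_le hx] at hs
  exact pl_of_nonneg (h s hs)

theorem potential_force_of_nonpos {a b : ℝ} {g : ℝ → ℝ} {x : ℝ} (hx : x ≤ 0)
    (h : ∀ s ∈ Icc x 0, g s ≤ 0) : potential (force a b g) x = a⁻¹ * potential g x := by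
  rw [← potential_const_mul]
  refine intervalIntegral.integral_congr fun s hs => ?_
  rw [uIcc_of_ge hx] at hs
  exact pl_of_nonpos (h s hs)

/-- The rate at which the energy is dissipated. -/
noncomputable def dissip (n a b : ℝ) : ℝ := (max a b)⁻¹ * (n * min a b)

theorem dissip_nonneg {n a b : ℝ} (hn : 0 ≤ n) (ha : 0 < a) (hb : 0 < b) : 0 ≤ dissip n a b := by
  unfold dissip
  have := lt_min ha hb
  have := ha.trans_le (le_max_left a b)
  positivity

theorem dissip_pos {n a b : ℝ} (hn : 0 < n) (ha : 0 < a) (hb : 0 < b) : 0 < dissip n a b := by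
  unfold dissip
  have := lt_min ha hb
  have := ha.trans_le (le_max_left a b)
  positivity

/-- The left side is the derivative of the energy. It is p times the difference of two values of `pl
a⁻¹ b⁻¹` whose arguments differ by the damping term; that term has the sign of p, and the slopes are
at least 1 / max a b. -/
theorem mul_acc_add_force_le {n a b : ℝ} (hn : 0 ≤ n) (ha : 0 < a) (hb : 0 < b) (g : ℝ → ℝ)
    {r : ℝ} (hr : 0 < r) (u p : ℝ) :
    p * acc n a b g r u p + force a b g u * p ≤ -(dissip n a b * p ^ 2 / r) := by
  have hκ : 0 < max a b := ha.trans_le (le_max_left a b)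
  have hka := inv_anti₀ ha (le_max_left a b)
  have hkb := inv_anti₀ hb (le_max_right a b)
  have hf : force a b g u = -pl a⁻¹ b⁻¹ (-g u) := by simp [force, pl_neg]
  have hX : min a b * p ^ 2 ≤ p * pl a b p := mul_pl_ge (min_le_left a b) (min_le_right a b) p
  have hX' : (max a b)⁻¹ * (n / r) * (min a b * p ^ 2) ≤
      (max a b)⁻¹ * (n / r) * (p * pl a b p) := by gcongr
  have hd : dissip n a b * p ^ 2 / r = (max a b)⁻¹ * (n / r) * (min a b * p ^ 2) := by
    unfold dissip; ring
  rw [hf, hd, acc]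
  have hnr : 0 ≤ n / r := by positivity
  set Φ := pl a⁻¹ b⁻¹
  set X := n / r * pl a b p with hXdef
  have hpX : (max a b)⁻¹ * (n / r) * (p * pl a b p) = p * ((max a b)⁻¹ * X) := by
    rw [hXdef]; ring
  rcases le_total 0 p with hp | hp
  · have hX0 : 0 ≤ X := mul_nonneg hnr (by rw [pl_of_nonneg hp]; positivity)
    have := le_pl_sub hka hkb (show -X - g u ≤ -g u by linarith)
    have h2 : p * ((max a b)⁻¹ * X) ≤ p * (Φ (-g u) - Φ (-X - g u)) := by
      refine mul_le_mul_of_nonneg_left (le_trans (le_of_eq ?_) this) hp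
      ring
    linarith
  · have hX0 : X ≤ 0 := mul_nonpos_of_nonneg_of_nonpos hnr (by
      rw [pl_of_nonpos hp]; exact mul_nonpos_of_nonneg_of_nonpos hb.le hp)
    have := le_pl_sub hka hkb (show -g u ≤ -X - g u by linarith)
    have h2 : p * (Φ (-X - g u) - Φ (-g u)) ≤ p * (-((max a b)⁻¹ * X)) := by
      refine mul_le_mul_of_nonpos_left (le_trans (le_of_eq ?_) this) hp
      ring
    linarith

/-- The energy of the state `(u, p)`. -/
noncomputable def energy (a b : ℝ) (g : ℝ → ℝ) (u p : ℝ) : ℝ :=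
  p ^ 2 / 2 + potential (force a b g) u

section

variable {n a b : ℝ} {g : ℝ → ℝ} {R : EReal} {u p : ℝ → ℝ}

theorem RadialODE.hasDerivAt_energy (h : RadialODE n a b g R u p) (hg : Continuous g) {r : ℝ}
    (h0 : 0 < r) (hr : (r : EReal) < R) :
    HasDerivAt (fun r => energy a b g (u r) (p r))
      (p r * acc n a b g r (u r) (p r) + force a b g (u r) * p r) r := by
  unfold energy
  refine ((((h.hasDerivAt_right r h0 hr).pow 2).div_const 2).add
    ((hasDerivAt_potential (continuous_force hg) (u r)).comp r
      (h.hasDerivAt_left r h0 hr))).congr_deriv ?_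
  simp
  ring

theorem RadialODE.continuousOn_energy (h : RadialODE n a b g R u p) (hg : Continuous g) :
    ContinuousOn (fun r => energy a b g (u r) (p r)) (dom R) := by
  unfold energy
  exact ((h.continuousOn_right.pow 2).div_const 2).add
    ((continuous_potential (continuous_force hg)).comp_continuousOn h.continuousOn_left)

theorem RadialODE.antitoneOn_energy (h : RadialODE n a b g R u p) (hn : 0 ≤ n) (ha : 0 < a)
    (hb : 0 < b) (hg : Continuous g) :
    AntitoneOn (fun r => energy a b g (u r) (p r)) (dom R) := by
  refine antitoneOn_of_hasDerivAt_nonpos (convex_dom R) (h.continuousOn_energy hg)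
    (f' := fun r => p r * acc n a b g r (u r) (p r) + force a b g (u r) * p r) ?_ ?_
  · rw [interior_dom]
    exact fun r hr => h.hasDerivAt_energy hg hr.1 hr.2
  · rw [interior_dom]
    intro r hr
    have h1 := mul_acc_add_force_le hn ha hb g hr.1 (u r) (p r)
    have h2 : 0 ≤ dissip n a b * p r ^ 2 / r :=
      div_nonneg (mul_nonneg (dissip_nonneg hn ha hb) (sq_nonneg _)) hr.1.le
    linarith

theorem potential_force_le_energy (a b : ℝ) (g : ℝ → ℝ) (u p : ℝ) :
    potential (force a b g) u ≤ energy a b g u p := by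
  unfold energy
  linarith [sq_nonneg p]

/-- Potential barrier: being at β costs at least H(β), and the energy never increases. -/
theorem RadialODE.ne_of_energy_lt (h : RadialODE n a b g R u p) (hn : 0 ≤ n) (ha : 0 < a)
    (hb : 0 < b) (hg : Continuous g) {β r₁ : ℝ} (hr₁ : 0 ≤ r₁)
    (hβ : energy a b g (u r₁) (p r₁) < potential (force a b g) β) {r : ℝ} (hr : r ∈ dom R)
    (hrr : r₁ ≤ r) : u r ≠ β := by
  intro hu
  have h1 : r₁ ∈ dom R := Icc_subset_dom hr ⟨hr₁, hrr⟩
  have h2 := h.antitoneOn_energy hn ha hb hg h1 hr hrr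
  have h3 := potential_force_le_energy a b g (u r) (p r)
  simp only at h2
  rw [hu] at h2 h3
  linarith

theorem RadialODE.lt_of_energy_lt (h : RadialODE n a b g R u p) (hn : 0 ≤ n) (ha : 0 < a)
    (hb : 0 < b) (hg : Continuous g) {β r₁ : ℝ} (hr₁ : 0 ≤ r₁) (hu : u r₁ < β)
    (hβ : energy a b g (u r₁) (p r₁) < potential (force a b g) β) {r : ℝ} (hr : r ∈ dom R)
    (hrr : r₁ ≤ r) : u r < β := by
  by_contra hlt
  have hs : Icc r₁ r ⊆ dom R := (Icc_subset_Icc_left hr₁).trans (Icc_subset_dom hr)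
  obtain ⟨s, hs1, hs2⟩ := intermediate_value_Icc hrr (h.continuousOn_left.mono hs)
    ⟨hu.le, not_lt.mp hlt⟩
  exact h.ne_of_energy_lt hn ha hb hg hr₁ hβ (hs hs1) hs1.1 hs2

theorem RadialODE.gt_of_energy_lt (h : RadialODE n a b g R u p) (hn : 0 ≤ n) (ha : 0 < a)
    (hb : 0 < b) (hg : Continuous g) {β r₁ : ℝ} (hr₁ : 0 ≤ r₁) (hu : β < u r₁)
    (hβ : energy a b g (u r₁) (p r₁) < potential (force a b g) β) {r : ℝ} (hr : r ∈ dom R)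
    (hrr : r₁ ≤ r) : β < u r := by
  by_contra hlt
  have hs : Icc r₁ r ⊆ dom R := (Icc_subset_Icc_left hr₁).trans (Icc_subset_dom hr)
  obtain ⟨s, hs1, hs2⟩ := intermediate_value_Icc' hrr (h.continuousOn_left.mono hs)
    ⟨not_lt.mp hlt, hu.le⟩
  exact h.ne_of_energy_lt hn ha hb hg hr₁ hβ (hs hs1) hs1.1 hs2

theorem RadialODE.energy_zero (h : RadialODE n a b g R u p) :
    energy a b g (u 0) (p 0) = potential (force a b g) (u 0) := by
  simp [energy, h.right_zero]

/-! ### Growth from above the last zero of `g` -/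

theorem nonneg_of_hasDerivAt_nonneg {f f' : ℝ → ℝ} {ρ : ℝ} (hf : ContinuousOn f (Icc 0 ρ))
    (hf0 : 0 ≤ f 0) (hd : ∀ r ∈ Ioo 0 ρ, HasDerivAt f (f' r) r)
    (h : ∀ r ∈ Ioo 0 ρ, f r < 0 → 0 ≤ f' r) (hρ : 0 ≤ ρ) : 0 ≤ f ρ := by
  by_contra hneg
  have hS : IsCompact (Icc 0 ρ ∩ f ⁻¹' Ici 0) :=
    isCompact_Icc.of_isClosed_subset (hf.preimage_isClosed_of_isClosed isClosed_Icc isClosed_Ici)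
      inter_subset_left
  obtain ⟨t, ht, hmax⟩ := hS.exists_isGreatest ⟨0, ⟨le_rfl, hρ⟩, hf0⟩
  have hlt : ∀ s ∈ Ioo t ρ, f s < 0 := by
    intro s hs
    by_contra hs'
    exact absurd (hmax ⟨⟨ht.1.1.trans hs.1.le, hs.2.le⟩, not_lt.mp hs'⟩) (not_le.mpr hs.1)
  have hsub : Ioo t ρ ⊆ Ioo 0 ρ := Ioo_subset_Ioo_left ht.1.1
  have hanti : AntitoneOn (fun s => -f s) (Icc t ρ) := by
    refine antitoneOn_of_hasDerivAt_nonpos (convex_Icc _ _) (f' := fun s => -f' s)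
      (hf.mono (Icc_subset_Icc_left ht.1.1)).neg ?_ ?_
    · rw [interior_Icc]; exact fun s hs => (hd s (hsub hs)).neg
    · rw [interior_Icc]; exact fun s hs => neg_nonpos.mpr (h s (hsub hs) (hlt s hs))
  have h1 := hanti (left_mem_Icc.mpr ht.1.2) (right_mem_Icc.mpr ht.1.2) ht.1.2
  have h2 : 0 ≤ f t := ht.2
  simp only at h1
  linarith

/-- Comparison of u' with the line ηr, where c = (n + 1) κ η and κ = max a b. Wherever u' < ηr the
damping is at most nκη, which leaves a push of at least κη and hence u'' ≥ η. -/
theorem RadialODE.le_deriv (h : RadialODE n a b g R u p) (hn : 0 ≤ n) (ha : 0 < a) (hb : 0 < b)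
    {c ρ : ℝ} (hρ : ρ ∈ dom R) (hc : 0 < c) (hgc : ∀ r ∈ Icc 0 ρ, g (u r) ≤ -c) :
    c / ((n + 1) * max a b) * ρ ≤ p ρ := by
  have hκ : 0 < max a b := ha.trans_le (le_max_left a b)
  have hs := Icc_subset_dom hρ
  set η := c / ((n + 1) * max a b) with hη
  have hη0 : 0 < η := by positivity
  have hcη : c = (n + 1) * max a b * η := by rw [hη]; field_simp
  have key := nonneg_of_hasDerivAt_nonneg (f := fun r => p r - η * r)
    (f' := fun r => acc n a b g r (u r) (p r) - η) (ρ := ρ)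
    ((h.continuousOn_right.mono hs).sub (by fun_prop)) (by simp [h.right_zero]) ?_ ?_ hρ.1
  · linarith
  · intro r hr
    have h1 := h.hasDerivAt_right r hr.1 (hs (Ioo_subset_Icc_self hr)).2
    exact (h1.sub ((hasDerivAt_id r).const_mul η)).congr_deriv (by simp)
  · intro r hr hneg
    have hpη : p r ≤ η * r := by linarith
    have hηr : 0 ≤ η * r := mul_nonneg hη0.le hr.1.le
    have h1 : pl a b (p r) ≤ a * (η * r) :=
      (pl_mono ha.le hb.le hpη).trans_eq (pl_of_nonneg hηr)
    have h2 : a * (η * r) ≤ max a b * (η * r) :=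
      mul_le_mul_of_nonneg_right (le_max_left a b) hηr
    have h3 : n / r * pl a b (p r) ≤ n / r * (max a b * (η * r)) :=
      mul_le_mul_of_nonneg_left (h1.trans h2) (div_nonneg hn hr.1.le)
    have h4 : n / r * (max a b * (η * r)) = n * max a b * η := by
      have := hr.1.ne'
      field_simp
    have h5 : max a b * η ≤ -(n / r * pl a b (p r)) - g (u r) := by
      have := hgc r (Ioo_subset_Icc_self hr)
      nlinarith
    have h6 : pl a⁻¹ b⁻¹ (max a b * η) ≤ acc n a b g r (u r) (p r) :=
      pl_mono (inv_pos.mpr ha).le (inv_pos.mpr hb).le h5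
    rw [pl_of_nonneg (by positivity)] at h6
    have h7 : η ≤ a⁻¹ * (max a b * η) := by
      rw [← mul_assoc]
      have : 1 ≤ a⁻¹ * max a b := by
        rw [inv_mul_eq_div, le_div_iff₀ ha, one_mul]
        exact le_max_left a b
      nlinarith
    linarith

/-- H decreases beyond α, so u cannot fall below u(0); then g(u) is bounded away from 0 on bounded
ranges and `RadialODE.le_deriv` applies. The continuation property enters as the hypothesis `htop`
so that the result also serves for -u. -/
theorem RadialODE.strictMonoOn_and_unbounded (h : RadialODE n a b g R u p) (hR : 0 < R)
    (hn : 0 ≤ n) (ha : 0 < a) (hb : 0 < b) (hg : Continuous g) {α : ℝ} (hα : α < u 0)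
    (hneg : ∀ s, α < s → g s < 0)
    (htop : ∀ M : ℝ, (∀ r ∈ dom R, |u r| ≤ M) → R = ⊤) :
    StrictMonoOn u (dom R) ∧ ∀ M : ℝ, ∃ r₀ ∈ dom R, ∀ r ∈ dom R, r₀ ≤ r → M < u r := by
  have hge : ∀ r ∈ dom R, u 0 ≤ u r := by
    intro r hr
    by_contra hlt
    obtain ⟨t, ht1, ht2⟩ := exists_between (max_lt hα (not_le.mp hlt))
    have hpot : potential (force a b g) (u 0) < potential (force a b g) t :=
      potential_gt (continuous_force hg) ht2 fun s hs =>
        force_neg ha (hneg s ((le_max_left _ _).trans_lt (ht1.trans hs.1)))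
    have := h.gt_of_energy_lt hn ha hb hg le_rfl ht2 (h.energy_zero.trans_lt hpot) hr hr.1
    exact absurd ((le_max_right α (u r)).trans_lt ht1) this.not_gt
  have hbd : ∀ M : ℝ, ∃ c > 0, ∀ s, u 0 ≤ s → s ≤ M → g s ≤ -c := by
    intro M
    obtain ⟨c, hc, hc'⟩ := (isCompact_Icc (a := u 0) (b := M)).exists_forall_le'
      (f := fun s => -g s) (a := 0) hg.neg.continuousOn
      (fun s hs => by simpa using hneg s (hα.trans_le hs.1))
    exact ⟨c, hc, fun s h1 h2 => by linarith [hc' s ⟨h1, h2⟩]⟩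
  have hκ : 0 < max a b := ha.trans_le (le_max_left a b)
  have hpos : ∀ r : ℝ, 0 < r → (r : EReal) < R → 0 < p r := by
    intro r h0 hr
    have hs := Icc_subset_dom (show r ∈ dom R from ⟨h0.le, hr⟩)
    obtain ⟨M, hM⟩ := (isCompact_Icc (a := 0) (b := r)).exists_bound_of_continuousOn
      (h.continuousOn_left.mono hs)
    obtain ⟨c, hc, hcM⟩ := hbd M
    have := h.le_deriv hn ha hb ⟨h0.le, hr⟩ hc fun s hs' =>
      hcM _ (hge s (hs hs')) ((le_abs_self _).trans (hM s hs'))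
    refine lt_of_lt_of_le ?_ this
    positivity
  have hmono : StrictMonoOn u (dom R) := by
    refine strictMonoOn_of_deriv_pos (convex_dom R) h.continuousOn_left fun r hr => ?_
    rw [interior_dom] at hr
    rw [(h.hasDerivAt_left r hr.1 hr.2).deriv]
    exact hpos r hr.1 hr.2
  refine ⟨hmono, fun M => ?_⟩
  by_contra! hcon
  have hle : ∀ r ∈ dom R, u r ≤ M := by
    intro r hr
    obtain ⟨s, hs, hrs, hsM⟩ := hcon r hr
    exact (hmono.monotoneOn hr hs hrs).trans hsM
  have hRtop : R = ⊤ := htop (max |u 0| |M|) fun r hr => abs_le_max_abs_abs (hge r hr) (hle r hr)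
  subst hRtop
  obtain ⟨c, hc, hcM⟩ := hbd M
  set η := c / ((n + 1) * max a b) with hη
  have hη0 : 0 < η := by positivity
  have hp : ∀ r, 0 ≤ r → η * r ≤ p r := fun r hr =>
    h.le_deriv hn ha hb ⟨hr, EReal.coe_lt_top r⟩ hc fun s hs' =>
      have hs : s ∈ dom ⊤ := ⟨hs'.1, EReal.coe_lt_top s⟩
      hcM _ (hge s hs) (hle s hs)
  have hanti : AntitoneOn (fun r => η * r ^ 2 / 2 - u r) (dom ⊤) := by
    refine antitoneOn_of_hasDerivAt_nonpos (convex_dom _) (f' := fun r => η * r - p r)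
      (ContinuousOn.sub (by fun_prop) h.continuousOn_left) ?_ ?_
    · rw [interior_dom]
      intro r hr
      refine ((((hasDerivAt_pow 2 r).const_mul η).div_const 2).sub
        (h.hasDerivAt_left r hr.1 hr.2)).congr_deriv ?_
      simp
      ring
    · rw [interior_dom]
      intro r hr
      linarith [hp r hr.1.le]
  -- Since r ≥ 1, ηr² / 2 ≥ ηr / 2 > M - u(0), against u(r) ≥ u(0) + ηr² / 2.
  set r : ℝ := (M - u 0) * 2 / η + 1 with hr
  have hM0 : u 0 ≤ M := hle 0 (zero_mem_dom hR)
  have hr1 : 1 ≤ r := by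
    have : 0 ≤ (M - u 0) * 2 / η := by
      have : 0 ≤ M - u 0 := by linarith
      positivity
    linarith
  have hrd : r ∈ dom ⊤ := ⟨by linarith, EReal.coe_lt_top r⟩
  have h1 := hanti (zero_mem_dom hR) hrd hrd.1
  have h2 := hle r hrd
  simp only at h1
  have h3 : η * r = (M - u 0) * 2 + η := by
    rw [hr]; field_simp
  nlinarith

end

/-! ### Decay and oscillation of bounded global solutions -/

section

variable {n a b : ℝ} {g : ℝ → ℝ} {u p : ℝ → ℝ}

/-- The dissipation c p² / r degenerates where p = 0. The corrector (c/2) u p / r has derivative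
(c/2)(p² - u f(u)) / r + O(1/r²), so the corrected energy loses (c/2)(p² + u f(u)) / r instead. If E
stayed above ε, this would be at least e / r, and the energy would tend to -∞ like -e log r. -/
theorem RadialODE.exists_energy_lt (h : RadialODE n a b g ⊤ u p) (hn : 0 < n) (ha : 0 < a)
    (hb : 0 < b) (hg : Continuous g) {B : ℝ} (hB : ∀ r, 0 ≤ r → |u r| ≤ B)
    (hsign : ∀ s, s ≠ 0 → |s| ≤ B → 0 < s * g s) {ε : ℝ} (hε : 0 < ε) :
    ∃ r, 1 ≤ r ∧ energy a b g (u r) (p r) < ε := by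
  by_contra! hcon
  have hmem : ∀ r : ℝ, 0 ≤ r → r ∈ dom ⊤ := fun r hr => ⟨hr, EReal.coe_lt_top r⟩
  set f := force a b g with hf
  have hfc : Continuous f := continuous_force hg
  have hfsign : ∀ s, s ≠ 0 → |s| ≤ B → 0 < s * f s := fun s h0 h1 =>
    mul_force_pos ha hb (hsign s h0 h1)
  have hfsign' : ∀ s, |s| ≤ B → 0 ≤ s * f s := fun s h1 => by
    rcases eq_or_ne s 0 with rfl | h0
    · simp
    · exact (hfsign s h0 h1).le
  have hH : ∀ s, |s| ≤ B → 0 ≤ potential f s := fun s h1 => by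
    rcases eq_or_ne s 0 with rfl | h0
    · simp
    · exact (potential_pos hfc hfsign h0 h1).le
  have hB0 : 0 ≤ B := (abs_nonneg _).trans (hB 0 le_rfl)
  obtain ⟨P, hP0, hP⟩ : ∃ P, 0 ≤ P ∧ ∀ r, 0 ≤ r → |p r| ≤ P := by
    refine ⟨Real.sqrt (2 * energy a b g (u 0) (p 0)), Real.sqrt_nonneg _, fun r hr => ?_⟩
    refine Real.abs_le_sqrt ?_
    have h1 := h.antitoneOn_energy hn.le ha hb hg (hmem 0 le_rfl) (hmem r hr) hr
    have h2 := hH (u r) (hB r hr)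
    simp only [energy] at h1 ⊢
    linarith
  obtain ⟨δ, hδ, hδ'⟩ : ∃ δ > 0, ∀ s, |s| ≤ B → ε / 2 ≤ potential f s → δ ≤ s * f s := by
    have hK : IsCompact (Icc (-B) B ∩ potential f ⁻¹' Ici (ε / 2)) :=
      isCompact_Icc.inter_right (isClosed_Ici.preimage (continuous_potential hfc))
    obtain ⟨δ, h1, h2⟩ := hK.exists_forall_le' (f := fun s => s * f s) (a := 0)
      (continuous_id.mul hfc).continuousOn (fun s hs => hfsign s (fun h0 => by
        have h3 : ε / 2 ≤ potential f s := hs.2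
        rw [h0, potential_zero] at h3
        linarith) (abs_le.mpr hs.1))
    exact ⟨δ, h1, fun s h3 h4 => h2 s ⟨abs_le.mp h3, h4⟩⟩
  -- With E ≥ ε, either H(u) ≥ ε/2, hence u f(u) ≥ δ, or H(u) ≤ ε/2, hence p² ≥ ε.
  have hlow : ∀ r, 1 ≤ r → min δ ε ≤ p r ^ 2 + u r * f (u r) := by
    intro r hr
    have h1 := hcon r hr
    have h2 := hB r (by linarith)
    unfold energy at h1
    rcases le_total (ε / 2) (potential f (u r)) with h3 | h3
    · exact (min_le_left _ _).trans ((hδ' _ h2 h3).trans (by linarith [sq_nonneg (p r)]))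
    · exact (min_le_right _ _).trans (by linarith [hfsign' _ h2])
  set k := min a b with hk
  set κ := max a b with hκ
  have hk0 : 0 < k := lt_min ha hb
  have hκ0 : 0 < κ := ha.trans_le (le_max_left a b)
  set c := dissip n a b with hc
  have hc0 : 0 < c := dissip_pos hn ha hb
  set D₀ := B * (k⁻¹ * (n * (κ * P))) with hD₀
  have hacc : ∀ r, 1 ≤ r → u r * acc n a b g r (u r) (p r) ≤ -(u r * f (u r)) + D₀ / r := by
    intro r hr
    have hr0 : 0 < r := by linarith
    have h1 : |acc n a b g r (u r) (p r) - acc n a b g r (u r) 0| ≤ k⁻¹ * (n / r * (κ * P)) := by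
      unfold acc
      refine (abs_pl_sub_le (inv_pos.mpr ha).le (inv_pos.mpr hb).le
        (inv_anti₀ hk0 (min_le_left a b)) (inv_anti₀ hk0 (min_le_right a b)) _ _).trans ?_
      refine mul_le_mul_of_nonneg_left ?_ (inv_pos.mpr hk0).le
      have h2 : |pl a b (p r)| ≤ κ * |p r| :=
        abs_pl_le ha.le hb.le (le_max_left a b) (le_max_right a b) _
      have h3 : (-(n / r * pl a b (p r)) - g (u r)) - (-(n / r * pl a b 0) - g (u r)) =
          -(n / r * pl a b (p r)) := by simp
      rw [h3, abs_neg, abs_mul, abs_of_nonneg (by positivity : 0 ≤ n / r)]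
      refine mul_le_mul_of_nonneg_left (h2.trans ?_) (by positivity)
      exact mul_le_mul_of_nonneg_left (hP r hr0.le) hκ0.le
    rw [acc_zero_right] at h1
    have h4 : u r * (acc n a b g r (u r) (p r) - -f (u r)) ≤ B * (k⁻¹ * (n / r * (κ * P))) := by
      refine (le_abs_self _).trans ?_
      rw [abs_mul]
      exact mul_le_mul (hB r hr0.le) h1 (abs_nonneg _) hB0
    have h5 : D₀ / r = B * (k⁻¹ * (n / r * (κ * P))) := by rw [hD₀]; ring
    rw [h5]
    linarith
  set D := c / 2 * (D₀ + B * P) with hD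
  set e := c / 2 * min δ ε with he
  have he0 : 0 < e := mul_pos (by positivity) (lt_min hδ hε)
  -- The term e log r offsets the guaranteed loss, and D / r absorbs the O(1/r²) errors.
  have hanti : AntitoneOn (fun r => energy a b g (u r) (p r) + c / 2 * (u r * p r / r)
      + (e * Real.log r + D * r⁻¹)) (Ici 1) := by
    have hpos : ∀ r ∈ Ici (1 : ℝ), r ≠ 0 := fun r hr => (zero_lt_one.trans_le hr).ne'
    have hsub : Ici (1 : ℝ) ⊆ dom ⊤ := fun r hr => hmem r (zero_le_one.trans hr)
    refine antitoneOn_of_hasDerivAt_nonpos (convex_Ici 1) (f' := fun r =>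
      (p r * acc n a b g r (u r) (p r) + f (u r) * p r)
      + c / 2 * (((p r * p r + u r * acc n a b g r (u r) (p r)) * r - u r * p r * 1) / r ^ 2)
      + (e * r⁻¹ + D * (-(r ^ 2)⁻¹))) ?_ ?_ ?_
    · refine (((h.continuousOn_energy hg).mono hsub).add (continuousOn_const.mul
        (ContinuousOn.div ((h.continuousOn_left.mul h.continuousOn_right).mono hsub)
          continuousOn_id hpos))).add ((continuousOn_const.mul
        (ContinuousOn.log continuousOn_id hpos)).add
        (continuousOn_const.mul (continuousOn_id.inv₀ hpos)))
    · rw [interior_Ici]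
      intro r hr
      have hr0 : 0 < r := zero_lt_one.trans hr
      have hdu := h.hasDerivAt_left r hr0 (EReal.coe_lt_top r)
      have hdp := h.hasDerivAt_right r hr0 (EReal.coe_lt_top r)
      exact ((h.hasDerivAt_energy hg hr0 (EReal.coe_lt_top r)).add
        (((hdu.mul hdp).div (hasDerivAt_id r) hr0.ne').const_mul (c / 2))).add
        (((Real.hasDerivAt_log hr0.ne').const_mul e).add
          ((hasDerivAt_inv hr0.ne').const_mul D))
    · rw [interior_Ici]
      intro r hr
      have hr1 : 1 ≤ r := le_of_lt hr
      have hr0 : 0 < r := by linarith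
      have h1 := mul_acc_add_force_le hn.le ha hb g hr0 (u r) (p r)
      have h2 := hacc r hr1
      have h3 := hlow r hr1
      have h4 : -(u r * p r) ≤ B * P := by
        refine (neg_le_abs _).trans ?_
        rw [abs_mul]
        exact mul_le_mul (hB r hr0.le) (hP r hr0.le) (abs_nonneg _) hB0
      have h5 : (((p r * p r + u r * acc n a b g r (u r) (p r)) * r - u r * p r * 1) / r ^ 2)
          ≤ (p r ^ 2 - u r * f (u r)) / r + (D₀ + B * P) / r ^ 2 := by
        have : (p r ^ 2 - u r * f (u r)) / r + (D₀ + B * P) / r ^ 2 =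
            ((p r ^ 2 - u r * f (u r) + D₀ / r) * r + B * P) / r ^ 2 := by
          field_simp
          ring
        rw [this]
        gcongr
        have h6 : (p r * p r + u r * acc n a b g r (u r) (p r)) * r ≤
            (p r ^ 2 - u r * f (u r) + D₀ / r) * r :=
          mul_le_mul_of_nonneg_right (by nlinarith) hr0.le
        linarith
      have h6 := mul_le_mul_of_nonneg_left h5 (by positivity : 0 ≤ c / 2)
      have h7 : min δ ε / r ≤ (p r ^ 2 + u r * f (u r)) / r := by gcongr
      have h8 := mul_le_mul_of_nonneg_left h7 (by positivity : 0 ≤ c / 2)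
      have h9 : c / 2 * ((p r ^ 2 - u r * f (u r)) / r + (D₀ + B * P) / r ^ 2)
          = c * p r ^ 2 / r - c / 2 * ((p r ^ 2 + u r * f (u r)) / r) + D * (r ^ 2)⁻¹ := by
        rw [hD]; field_simp; ring
      have h10 : e * r⁻¹ = c / 2 * (min δ ε / r) := by rw [he]; ring
      rw [h10]
      linarith
  have hlog := Real.tendsto_log_atTop.const_mul_atTop he0
  set W := energy a b g (u 1) (p 1) + c / 2 * (u 1 * p 1 / 1)
      + (e * Real.log 1 + D * (1 : ℝ)⁻¹) with hW
  obtain ⟨r, hr1, hr2⟩ := ((eventually_ge_atTop 1).and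
    (hlog.eventually_gt_atTop (W + c / 2 * (B * P)))).exists
  have hr0 : 0 < r := by linarith
  have h1 := hanti (mem_Ici.mpr le_rfl) (mem_Ici.mpr hr1) hr1
  simp only at h1
  rw [← hW] at h1
  have h2 := hcon r hr1
  have h3 : -(B * P) ≤ u r * p r / r := by
    have h4 : |u r * p r / r| ≤ B * P := by
      rw [abs_div, abs_mul, abs_of_pos hr0, div_le_iff₀ hr0]
      calc |u r| * |p r| ≤ B * P := mul_le_mul (hB r hr0.le) (hP r hr0.le) (abs_nonneg _) hB0
        _ ≤ B * P * r := le_mul_of_one_le_right (mul_nonneg hB0 hP0) hr1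
    exact (abs_le.mp h4).1
  have h5 := mul_le_mul_of_nonneg_left h3 (by positivity : 0 ≤ c / 2)
  have h6 : 0 ≤ D * r⁻¹ := by positivity
  linarith

/-- The energy is nonincreasing and gets below every ε, so it tends to 0. Both of its terms are
nonnegative, and H vanishes only at 0 on [-B, B]. -/
theorem RadialODE.tendsto_zero (h : RadialODE n a b g ⊤ u p) (hn : 0 < n) (ha : 0 < a)
    (hb : 0 < b) (hg : Continuous g) {B : ℝ} (hB : ∀ r, 0 ≤ r → |u r| ≤ B)
    (hsign : ∀ s, s ≠ 0 → |s| ≤ B → 0 < s * g s) :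
    Tendsto u atTop (𝓝 0) ∧ Tendsto p atTop (𝓝 0) := by
  set f := force a b g with hf
  have hfc : Continuous f := continuous_force hg
  have hHpos : ∀ s, s ≠ 0 → |s| ≤ B → 0 < potential f s := fun s h0 h1 =>
    potential_pos hfc (fun s h0 h1 => mul_force_pos ha hb (hsign s h0 h1)) h0 h1
  have hev : ∀ ε > 0, ∀ᶠ r in atTop, 0 ≤ r ∧ energy a b g (u r) (p r) < ε := by
    intro ε hε
    obtain ⟨r₁, hr₁, hlt⟩ := h.exists_energy_lt hn ha hb hg hB hsign hε
    filter_upwards [eventually_ge_atTop r₁] with r hr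
    have h0 : 0 ≤ r := by linarith
    exact ⟨h0, (h.antitoneOn_energy hn.le ha hb hg ⟨by linarith, EReal.coe_lt_top _⟩
      ⟨h0, EReal.coe_lt_top _⟩ hr).trans_lt hlt⟩
  constructor
  · rw [Metric.tendsto_nhds]
    intro ε hε
    have hK : IsCompact (Icc (-B) B ∩ {s | ε ≤ |s|}) :=
      isCompact_Icc.inter_right (isClosed_le continuous_const continuous_abs)
    obtain ⟨δ, h1, h2⟩ := hK.exists_forall_le' (f := potential f) (a := 0)
      (continuous_potential hfc).continuousOn (fun s hs => hHpos s (fun h0 => by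
        have h3 : ε ≤ |s| := hs.2
        rw [h0, abs_zero] at h3
        linarith) (abs_le.mpr hs.1))
    filter_upwards [hev δ h1] with r hr
    rw [Real.dist_eq, sub_zero]
    by_contra hcon
    have h3 := h2 (u r) ⟨abs_le.mp (hB r hr.1), not_lt.mp hcon⟩
    have h4 := potential_force_le_energy a b g (u r) (p r)
    linarith [hr.2]
  · rw [Metric.tendsto_nhds]
    intro ε hε
    filter_upwards [hev (ε ^ 2 / 2) (by positivity)] with r hr
    rw [Real.dist_eq, sub_zero]
    refine abs_lt_of_sq_lt_sq ?_ hε.le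
    have h3 : 0 ≤ potential f (u r) := by
      rcases eq_or_ne (u r) 0 with h0 | h0
      · simp [h0]
      · exact (hHpos _ h0 (hB r hr.1)).le
    have h4 := hr.2
    unfold energy at h4
    linarith

theorem RadialODE.tendsto_acc (hg : Continuous g) (hg0 : g 0 = 0)
    (hu : Tendsto u atTop (𝓝 0)) (hp : Tendsto p atTop (𝓝 0)) :
    Tendsto (fun r => acc n a b g r (u r) (p r)) atTop (𝓝 0) := by
  unfold acc
  have h1 : Tendsto (fun r : ℝ => n / r) atTop (𝓝 0) := tendsto_const_nhds.div_atTop tendsto_id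
  have h2 : Tendsto (fun r => pl a b (p r)) atTop (𝓝 0) := by
    simpa [Function.comp_def] using ((continuous_pl a b).tendsto 0).comp hp
  have h3 : Tendsto (fun r => g (u r)) atTop (𝓝 0) := by
    simpa [hg0, Function.comp_def] using (hg.tendsto 0).comp hu
  have h4 := ((h1.mul h2).neg).sub h3
  have h5 := ((continuous_pl a⁻¹ b⁻¹).tendsto _).comp h4
  simpa [Function.comp_def] using h5

/-- Riccati argument: y = -u'/u satisfies y' = y² - u''/u. Since g(u)/u > γ and the damping is small
for large r, y' ≥ (y² + σ²)/2, so arctan(y/σ) grows at rate at least σ/2, which is impossible for a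
bounded function. -/
theorem RadialODE.not_eventually_pos (h : RadialODE n a b g ⊤ u p) (hn : 0 ≤ n) (ha : 0 < a)
    (hb : 0 < b) (hg0 : g 0 = 0) (hgd : DifferentiableAt ℝ g 0) (hgpos : 0 < deriv g 0)
    (hu : Tendsto u atTop (𝓝 0)) : ¬ ∀ᶠ r in atTop, 0 < u r := by
  intro hpos
  set γ := deriv g 0 / 2 with hγ
  have hγ0 : 0 < γ := by positivity
  have hslope : ∀ᶠ s in 𝓝[≠] (0 : ℝ), γ < slope g 0 s :=
    (hasDerivAt_iff_tendsto_slope.mp hgd.hasDerivAt).eventually_const_lt (by linarith)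
  have hu' : Tendsto u atTop (𝓝[≠] 0) :=
    tendsto_nhdsWithin_iff.mpr ⟨hu, hpos.mono fun r hr => hr.ne'⟩
  set κ := max a b with hκ
  have hκ0 : 0 < κ := ha.trans_le (le_max_left a b)
  set σ := Real.sqrt (κ⁻¹ * γ) with hσ
  have hσ0 : 0 < σ := Real.sqrt_pos.mpr (by positivity)
  have hσ2 : σ ^ 2 = κ⁻¹ * γ := Real.sq_sqrt (by positivity)
  have hsmall : ∀ᶠ r in atTop, a⁻¹ * (n * κ) / r < σ :=
    (tendsto_const_nhds.div_atTop tendsto_id).eventually_lt_const hσ0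
  obtain ⟨r₀, hr₀⟩ := eventually_atTop.mp
    (hpos.and ((hu'.eventually hslope).and (hsmall.and (eventually_gt_atTop 0))))
  have hr₀pos : 0 < r₀ := (hr₀ r₀ le_rfl).2.2.2
  have hanti : AntitoneOn (fun r => σ / 2 * r - Real.arctan (-(p r / u r) / σ)) (Ici r₀) := by
    have hd : ∀ r ∈ Ici r₀, HasDerivAt (fun r => σ / 2 * r - Real.arctan (-(p r / u r) / σ))
        (σ / 2 - 1 / (1 + (-(p r / u r) / σ) ^ 2) *
          (-((acc n a b g r (u r) (p r) * u r - p r * p r) / u r ^ 2) / σ)) r := by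
      intro r hr
      obtain ⟨h1, h2, h3, h4⟩ := hr₀ r hr
      have hq := (h.hasDerivAt_right r h4 (EReal.coe_lt_top r)).div
        (h.hasDerivAt_left r h4 (EReal.coe_lt_top r)) h1.ne'
      exact (((hasDerivAt_id r).const_mul (σ / 2)).congr_deriv (mul_one _)).sub
        (hq.neg.div_const σ).arctan
    refine antitoneOn_of_hasDerivAt_nonpos (convex_Ici r₀)
      (fun r hr => (hd r hr).continuousAt.continuousWithinAt)
      (fun r hr => hd r (interior_subset hr)) fun r hr => ?_
    obtain ⟨h1, h2, h3, h4⟩ := hr₀ r (interior_subset hr)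
    set y := -(p r / u r) with hy
    set A := acc n a b g r (u r) (p r) with hA
    have hgu : γ < g (u r) / u r := by simpa [slope_def_field, hg0] using h2
    have hpy : (u r)⁻¹ * p r = -y := by rw [hy]; ring
    have hAu : A / u r ≤ σ * |y| - σ ^ 2 := by
      -- Positive homogeneity of `pl` allows division by u > 0 inside both nonlinearities.
      have e1 : A / u r = pl a⁻¹ b⁻¹ (-(n / r * pl a b (-y)) - g (u r) / u r) := by
        rw [← hpy, pl_mul_of_nonneg a b (inv_pos.mpr h1).le, hA, acc, div_eq_inv_mul,
          ← pl_mul_of_nonneg _ _ (inv_pos.mpr h1).le]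
        congr 1
        ring
      have e2 : |pl a b (-y)| ≤ κ * |y| := by
        simpa using abs_pl_le ha.le hb.le (le_max_left a b) (le_max_right a b) (-y)
      have hnr : 0 ≤ n / r := by positivity
      have e3 : -(n / r * pl a b (-y)) ≤ n / r * (κ * |y|) := by
        have := mul_le_mul_of_nonneg_left ((neg_le_abs _).trans e2) hnr
        linarith
      have e4 : A / u r ≤ pl a⁻¹ b⁻¹ (n / r * (κ * |y|) - γ) := by
        rw [e1]
        exact pl_mono (inv_pos.mpr ha).le (inv_pos.mpr hb).le (by linarith)
      have e5 := le_pl_sub (inv_anti₀ ha (le_max_left a b)) (inv_anti₀ hb (le_max_right a b))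
        (show n / r * (κ * |y|) - γ ≤ n / r * (κ * |y|) by linarith)
      rw [pl_of_nonneg (s := n / r * (κ * |y|)) (by positivity)] at e5
      have e6 : a⁻¹ * (n / r * (κ * |y|)) = a⁻¹ * (n * κ) / r * |y| := by ring
      have e7 : a⁻¹ * (n * κ) / r * |y| ≤ σ * |y| := by gcongr
      have e8 : κ⁻¹ * (n / r * (κ * |y|) - (n / r * (κ * |y|) - γ)) = σ ^ 2 := by rw [hσ2]; ring
      linarith
    have e9 : -((A * u r - p r * p r) / u r ^ 2) = y ^ 2 - A / u r := by
      rw [hy]; field_simp; ring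
    -- From `hAu`: y² - σ|y| + σ² exceeds the left side by (|y| - σ)² / 2.
    have e10 : (y ^ 2 + σ ^ 2) / 2 ≤ y ^ 2 - A / u r := by
      rw [← sq_abs y]
      nlinarith [sq_nonneg (|y| - σ)]
    rw [e9]
    have e11 : 1 / (1 + (y / σ) ^ 2) * ((y ^ 2 + σ ^ 2) / 2 / σ) = σ / 2 := by
      have : σ ^ 2 + y ^ 2 ≠ 0 := by positivity
      field_simp
      ring
    have e12 : 1 / (1 + (y / σ) ^ 2) * ((y ^ 2 + σ ^ 2) / 2 / σ) ≤
        1 / (1 + (y / σ) ^ 2) * ((y ^ 2 - A / u r) / σ) := by gcongr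
    linarith
  have hlin : Tendsto (fun r : ℝ => σ / 2 * r) atTop atTop :=
    tendsto_id.const_mul_atTop (by positivity)
  obtain ⟨r, hr1, hr2⟩ := ((eventually_ge_atTop r₀).and (hlin.eventually_gt_atTop
    (σ / 2 * r₀ - Real.arctan (-(p r₀ / u r₀) / σ) + Real.pi / 2))).exists
  have h1 := hanti (mem_Ici.mpr le_rfl) (mem_Ici.mpr hr1) hr1
  have h2 := Real.arctan_lt_pi_div_two (-(p r / u r) / σ)
  simp only at h1
  linarith

theorem RadialODE.exists_zero_ge (h : RadialODE n a b g ⊤ u p) (hn : 0 ≤ n) (ha : 0 < a)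
    (hb : 0 < b) (hodd : ∀ s, g (-s) = -g s) (hg0 : g 0 = 0) (hgd : DifferentiableAt ℝ g 0)
    (hgpos : 0 < deriv g 0) (hu : Tendsto u atTop (𝓝 0)) {r₀ : ℝ} (hr₀ : 0 ≤ r₀) :
    ∃ z, r₀ ≤ z ∧ u z = 0 := by
  by_contra! hcon
  have hc : ContinuousOn u (Ici r₀) := h.continuousOn_left.mono fun r hr =>
    ⟨hr₀.trans hr, EReal.coe_lt_top r⟩
  have hsgn : (∀ r ∈ Ici r₀, 0 < u r) ∨ ∀ r ∈ Ici r₀, u r < 0 := by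
    by_contra! hne
    obtain ⟨⟨s, hs, hs'⟩, t, ht, ht'⟩ := hne
    obtain ⟨z, hz, hz'⟩ := isPreconnected_Ici.intermediate_value hs ht hc ⟨hs', ht'⟩
    exact hcon z hz hz'
  rcases hsgn with hs | hs
  · exact h.not_eventually_pos hn ha hb hg0 hgd hgpos hu
      ((eventually_ge_atTop r₀).mono fun r hr => hs r hr)
  -- -u solves the system with a and b exchanged, and the Riccati argument does not require them
  -- ordered.
  · exact (h.neg hodd).not_eventually_pos hn hb ha hg0 hgd hgpos (by simpa using hu.neg)
      ((eventually_ge_atTop r₀).mono fun r hr => neg_pos.mpr (hs r hr))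

theorem RadialODE.oscillating (h : RadialODE n a b g ⊤ u p) (hn : 0 ≤ n) (ha : 0 < a)
    (hb : 0 < b) (hodd : ∀ s, g (-s) = -g s) (hg0 : g 0 = 0) (hgd : DifferentiableAt ℝ g 0)
    (hgpos : 0 < deriv g 0) (hu : Tendsto u atTop (𝓝 0)) : Oscillating u := by
  have hz : ∀ m : ℕ, ∃ z, (m : ℝ) ≤ z ∧ u z = 0 := fun m =>
    h.exists_zero_ge hn ha hb hodd hg0 hgd hgpos hu m.cast_nonneg
  choose z hz1 hz2 using hz
  refine ⟨z, fun m => m.cast_nonneg.trans (hz1 m), hz2, ?_⟩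
  rintro ⟨M, hM⟩
  obtain ⟨m, hm⟩ := exists_nat_gt M
  exact absurd ((hz1 m).trans (hM (mem_range_self m))) (not_le.mpr hm)

theorem RadialODE.localized (h : RadialODE n a b g ⊤ u p) (hn : 0 < n) (ha : 0 < a)
    (hb : 0 < b) (hg : Continuous g) (hg0 : g 0 = 0) {B : ℝ} (hB : ∀ r, 0 ≤ r → |u r| ≤ B)
    (hsign : ∀ s, s ≠ 0 → |s| ≤ B → 0 < s * g s) : Localized u := by
  obtain ⟨h1, h2⟩ := h.tendsto_zero hn ha hb hg hB hsign
  have hd : ∀ r > 0, deriv u r = p r := fun r hr =>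
    (h.hasDerivAt_left r hr (EReal.coe_lt_top r)).deriv
  refine ⟨h1, h2.congr' ?_, (RadialODE.tendsto_acc (n := n) (a := a) (b := b) hg hg0 h1
    h2).congr' ?_⟩
  · filter_upwards [eventually_gt_atTop 0] with r hr using (hd r hr).symm
  · filter_upwards [eventually_gt_atTop 0] with r hr
    have hev : deriv u =ᶠ[𝓝 r] p := by
      filter_upwards [Ioi_mem_nhds hr] with s hs using hd s hs
    rw [hev.deriv_eq, (h.hasDerivAt_right r hr (EReal.coe_lt_top r)).deriv]

end

/-! ### Confinement below α, and the sup norm -/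

section

variable {n a b : ℝ} {g : ℝ → ℝ} {R α : EReal} {u p : ℝ → ℝ}

/-- Constant energy forces p = 0 on the interval, hence zero acceleration and g(u) = 0 there. The
strictness is what admits equality in the hypothesis on G in case 4. -/
theorem RadialODE.energy_lt (h : RadialODE n a b g R u p) (hn : 0 < n) (ha : 0 < a) (hb : 0 < b)
    (hg : Continuous g) {r₁ : ℝ} (h1 : 0 < r₁) (h1R : (r₁ : EReal) < R)
    (hne : ∀ r ∈ Ioo 0 r₁, g (u r) ≠ 0) :
    energy a b g (u r₁) (p r₁) < energy a b g (u 0) (p 0) := by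
  have hs := Icc_subset_dom (show r₁ ∈ dom R from ⟨h1.le, h1R⟩)
  have hanti := (h.antitoneOn_energy hn.le ha hb hg).mono hs
  refine lt_of_le_of_ne (hanti (left_mem_Icc.mpr h1.le) (right_mem_Icc.mpr h1.le) h1.le)
    fun heq => ?_
  have hconst : ∀ r ∈ Icc 0 r₁, energy a b g (u r) (p r) = energy a b g (u 0) (p 0) := fun r hr =>
    le_antisymm (hanti (left_mem_Icc.mpr h1.le) hr hr.1)
      (heq ▸ hanti hr (right_mem_Icc.mpr h1.le) hr.2)
  have hp : ∀ r ∈ Ioo 0 r₁, p r = 0 := by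
    intro r hr
    have hd := h.hasDerivAt_energy hg hr.1 (hs (Ioo_subset_Icc_self hr)).2
    have hd0 : HasDerivAt (fun r => energy a b g (u r) (p r)) 0 r :=
      (hasDerivAt_const r (energy a b g (u 0) (p 0))).congr_of_eventuallyEq (by
        filter_upwards [Icc_mem_nhds hr.1 hr.2] with s hs' using hconst s hs')
    have h2 := mul_acc_add_force_le hn.le ha hb g hr.1 (u r) (p r)
    rw [hd.unique hd0] at h2
    by_contra hp
    have h3 : 0 < dissip n a b * p r ^ 2 / r :=
      div_pos (mul_pos (dissip_pos hn ha hb) (by positivity)) hr.1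
    linarith
  have hr : r₁ / 2 ∈ Ioo 0 r₁ := ⟨by positivity, by linarith⟩
  have hd := h.hasDerivAt_right _ hr.1 (hs (Ioo_subset_Icc_self hr)).2
  have hd0 : HasDerivAt p 0 (r₁ / 2) :=
    (hasDerivAt_const (r₁ / 2) (0 : ℝ)).congr_of_eventuallyEq (by
      filter_upwards [Ioo_mem_nhds hr.1 hr.2] with s hs' using hp s hs')
  have h0 := hd.unique hd0
  rw [hp _ hr, acc_zero_right] at h0
  rcases lt_or_gt_of_ne (hne _ hr) with h2 | h2
  · have := force_neg (b := b) ha h2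
    linarith
  · have := force_pos (a := a) hb h2
    linarith

theorem nonneg_of_mem_Icc {x : ℝ} (hg0 : g 0 = 0)
    (hpos : ∀ s : ℝ, 0 < s → (s : EReal) < α → 0 < g s) (hx : (x : EReal) < α) {s : ℝ}
    (hs : s ∈ Icc 0 x) : 0 ≤ g s := by
  rcases hs.1.eq_or_lt with rfl | h
  · exact hg0.ge
  · exact (hpos s h ((EReal.coe_le_coe_iff.mpr hs.2).trans_lt hx)).le

theorem potential_force_eq {x : ℝ} (hg0 : g 0 = 0)
    (hpos : ∀ s : ℝ, 0 < s → (s : EReal) < α → 0 < g s) (hx0 : 0 ≤ x) (hx : (x : EReal) < α) :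
    potential (force a b g) x = b⁻¹ * potential g x :=
  potential_force_of_nonneg hx0 fun _ => nonneg_of_mem_Icc hg0 hpos hx

theorem potential_force_neg_eq {x : ℝ} (hg0 : g 0 = 0) (hodd : ∀ s, g (-s) = -g s)
    (hpos : ∀ s : ℝ, 0 < s → (s : EReal) < α → 0 < g s) (hx0 : 0 ≤ x) (hx : (x : EReal) < α) :
    potential (force a b g) (-x) = a⁻¹ * potential g x := by
  rw [← potential_even hodd, potential_force_of_nonpos (neg_nonpos.mpr hx0)]
  intro s hs
  have := nonneg_of_mem_Icc hg0 hpos hx (s := -s) ⟨by linarith [hs.2], by linarith [hs.1]⟩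
  rw [hodd] at this
  linarith

theorem potential_lt_of_lt {x y : ℝ} (hg : Continuous g)
    (hpos : ∀ s : ℝ, 0 < s → (s : EReal) < α → 0 < g s) (hx0 : 0 ≤ x) (hxy : x < y)
    (hy : (y : EReal) < α) : potential g x < potential g y :=
  potential_lt hg hxy fun s hs => hpos s (hx0.trans_lt hs.1)
    ((EReal.coe_lt_coe_iff.mpr hs.2).trans hy)

theorem exists_real_between {x y : ℝ} (hxy : x < y) (hx : (x : EReal) < α) :
    ∃ t : ℝ, x < t ∧ t < y ∧ (t : EReal) < α := by
  obtain ⟨t, h1, h2⟩ := EReal.lt_iff_exists_real_btwn.mp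
    (lt_min hx (EReal.coe_lt_coe_iff.mpr hxy))
  rw [lt_min_iff] at h2
  exact ⟨t, by exact_mod_cast h1, by exact_mod_cast h2.2, h2.1⟩

/-- The initial energy is G(u(0))/b. For every t in (u(0), α), both t and -t are barriers, because
H(-t) = G(t)/a ≥ G(t)/b = H(t); here a ≤ b is essential. -/
theorem RadialODE.abs_le_of_pos (h : RadialODE n a b g R u p) (hn : 0 ≤ n) (ha : 0 < a)
    (hab : a ≤ b) (hg : Continuous g) (hg0 : g 0 = 0) (hodd : ∀ s, g (-s) = -g s)
    (hpos : ∀ s : ℝ, 0 < s → (s : EReal) < α → 0 < g s) (h0 : 0 < u 0)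
    (h0α : ((u 0 : ℝ) : EReal) < α) {r : ℝ} (hr : r ∈ dom R) : |u r| ≤ u 0 := by
  have hb : 0 < b := ha.trans_le hab
  have hE : energy a b g (u 0) (p 0) = b⁻¹ * potential g (u 0) := by
    rw [h.energy_zero, potential_force_eq hg0 hpos h0.le h0α]
  by_contra hlt
  obtain ⟨t, ht1, ht2, ht3⟩ := exists_real_between (not_le.mp hlt) h0α
  have ht0 : 0 < t := h0.trans ht1
  have hG : potential g (u 0) < potential g t := potential_lt_of_lt hg hpos h0.le ht1 ht3
  have hG0 : 0 < potential g t := by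
    simpa using potential_lt_of_lt hg hpos le_rfl ht0 ht3
  have hup : u r < t := by
    refine h.lt_of_energy_lt hn ha hb hg le_rfl ht1 ?_ hr hr.1
    rw [hE, potential_force_eq hg0 hpos ht0.le ht3]
    exact mul_lt_mul_of_pos_left hG (inv_pos.mpr hb)
  have hlow : -t < u r := by
    refine h.gt_of_energy_lt hn ha hb hg le_rfl (by linarith) ?_ hr hr.1
    rw [hE, potential_force_neg_eq hg0 hodd hpos ht0.le ht3]
    calc b⁻¹ * potential g (u 0) < b⁻¹ * potential g t :=
          mul_lt_mul_of_pos_left hG (inv_pos.mpr hb)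
      _ ≤ a⁻¹ * potential g t := by gcongr
  exact absurd (abs_lt.mpr ⟨hlow, hup⟩) ht2.not_gt

theorem exists_lt_potential (hg : Continuous g) (hα : 0 < α) {c : ℝ}
    (hc : (c : EReal) < potentialAt g α) :
    ∃ t : ℝ, 0 < t ∧ (t : EReal) < α ∧ c < potential g t := by
  unfold potentialAt at hc
  split_ifs at hc with htop
  · obtain ⟨t, h1, h2⟩ := ((frequently_lt_of_lt_limsup (by isBoundedDefault) hc).and_eventually
      (eventually_gt_atTop 0)).exists
    exact ⟨t, h2, htop ▸ EReal.coe_lt_top t, by exact_mod_cast h1⟩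
  · lift α to ℝ using ⟨htop, (EReal.bot_lt_zero.trans hα).ne'⟩
    rw [EReal.toReal_coe, EReal.coe_lt_coe_iff] at hc
    have hα' : 0 < α := by simpa using hα
    have h1 : ∀ᶠ t in 𝓝[<] α, c < potential g t :=
      ((continuous_potential hg).continuousAt.eventually_const_lt hc).filter_mono
        nhdsWithin_le_nhds
    obtain ⟨t, h2, h3⟩ := (h1.and (Ioo_mem_nhdsLT hα')).exists
    exact ⟨t, h3.1, by exact_mod_cast h3.2, h2⟩

/-- Below, points under u(0) are barriers as before. Above, the initial energy G(u(0))/a may equal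
G(α)/b, so one first waits until a time `r₁` at which u is still negative but energy has been lost;
then some β < α is a barrier. -/
theorem RadialODE.exists_abs_le_of_neg (h : RadialODE n a b g R u p) (hR : 0 < R) (hn : 0 < n)
    (ha : 0 < a) (hb : 0 < b) (hg : Continuous g) (hg0 : g 0 = 0) (hodd : ∀ s, g (-s) = -g s)
    (hα : 0 < α) (hpos : ∀ s : ℝ, 0 < s → (s : EReal) < α → 0 < g s) (h0 : u 0 < 0)
    (h0α : ((-u 0 : ℝ) : EReal) < α)
    (hG : ((b * potential g (u 0) : ℝ) : EReal) ≤ (a : EReal) * potentialAt g α) :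
    ∃ B : ℝ, (B : EReal) < α ∧ ∀ r ∈ dom R, |u r| ≤ B := by
  have h0' : 0 < -u 0 := neg_pos.mpr h0
  have hE : energy a b g (u 0) (p 0) = a⁻¹ * potential g (-u 0) := by
    rw [h.energy_zero, ← potential_force_neg_eq hg0 hodd hpos h0'.le h0α, neg_neg]
  have hlow : ∀ r ∈ dom R, u 0 ≤ u r := by
    intro r hr
    by_contra hlt
    obtain ⟨t, ht1, ht2, ht3⟩ := exists_real_between (neg_lt_neg (not_le.mp hlt)) h0α
    have ht0 : 0 < t := h0'.trans ht1
    have : -t < u r := by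
      refine h.gt_of_energy_lt hn.le ha hb hg le_rfl (by linarith) ?_ hr hr.1
      rw [hE, potential_force_neg_eq hg0 hodd hpos ht0.le ht3]
      exact mul_lt_mul_of_pos_left (potential_lt_of_lt hg hpos h0'.le ht1 ht3) (inv_pos.mpr ha)
    linarith
  obtain ⟨r₁, hr₁, hr₁R, hneg⟩ : ∃ r₁ : ℝ, 0 < r₁ ∧ (r₁ : EReal) < R ∧
      ∀ r ∈ Icc 0 r₁, u r < 0 := by
    obtain ⟨ρ, hρ, hρR⟩ := exists_pos_mem_dom hR
    have hev := (h.continuousOn_left 0 (zero_mem_dom hR)).eventually_lt_const h0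
    obtain ⟨ε, hε, hball⟩ := Metric.mem_nhdsWithin_iff.mp hev
    refine ⟨min ρ (ε / 2), by positivity,
      (EReal.coe_le_coe_iff.mpr (min_le_left _ _)).trans_lt hρR, fun r hr => hball ⟨?_, ?_⟩⟩
    · rw [Metric.mem_ball, Real.dist_eq, sub_zero, abs_of_nonneg hr.1]
      linarith [hr.2.trans (min_le_right _ _)]
    · exact ⟨hr.1, (EReal.coe_le_coe_iff.mpr (hr.2.trans (min_le_left _ _))).trans_lt hρR⟩
  have hs := Icc_subset_dom (show r₁ ∈ dom R from ⟨hr₁.le, hr₁R⟩)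
  have hV := h.energy_lt hn ha hb hg hr₁ hr₁R fun r hr => by
    have hr' := Ioo_subset_Icc_self hr
    have h1 := hneg r hr'
    have h2 := hlow r (hs hr')
    have h3 := hpos (-u r) (by linarith)
      ((EReal.coe_le_coe_iff.mpr (by linarith)).trans_lt h0α)
    rw [hodd] at h3
    linarith
  rw [hE, potential_even hodd] at hV
  set V := energy a b g (u r₁) (p r₁) with hVdef
  have hbV : ((b * V : ℝ) : EReal) < potentialAt g α := by
    by_contra hle
    have h1 := hG.trans (mul_le_mul_of_nonneg_left (not_lt.mp hle)
      (by exact_mod_cast ha.le : (0 : EReal) ≤ a))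
    rw [← EReal.coe_mul, EReal.coe_le_coe_iff] at h1
    have h2 := mul_lt_mul_of_pos_left hV (mul_pos ha hb)
    have h3 : a * b * (a⁻¹ * potential g (u 0)) = b * potential g (u 0) := by field_simp
    linarith
  obtain ⟨β, hβ0, hβα, hβ⟩ := exists_lt_potential hg hα hbV
  have hup : ∀ r ∈ dom R, u r < β := by
    intro r hr
    rcases le_total r r₁ with h1 | h1
    · exact (hneg r ⟨hr.1, h1⟩).trans hβ0
    · refine h.lt_of_energy_lt hn.le ha hb hg hr₁.le
        ((hneg r₁ ⟨hr₁.le, le_rfl⟩).trans hβ0) ?_ hr h1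
      rw [potential_force_eq hg0 hpos hβ0.le hβα, lt_inv_mul_iff₀ hb]
      exact hβ
  refine ⟨max β (-u 0), ?_, fun r hr => abs_le.mpr ⟨?_, ?_⟩⟩
  · rcases max_choice β (-u 0) with h1 | h1 <;> rw [h1] <;> assumption
  · linarith [hlow r hr, le_max_right β (-u 0)]
  · exact (hup r hr).le.trans (le_max_left _ _)

theorem supNorm_le {B : ℝ} (hB : ∀ r, 0 ≤ r → |u r| ≤ B) : supNorm u ≤ (B : EReal) := by
  have hB0 : 0 ≤ B := (abs_nonneg _).trans (hB 0 le_rfl)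
  have h1 : eLpNorm u ⊤ (volume.restrict (Ioi (0 : ℝ))) ≤ ENNReal.ofReal B := by
    rw [eLpNorm_exponent_top]
    refine eLpNormEssSup_le_of_ae_bound ?_
    filter_upwards [ae_restrict_mem measurableSet_Ioi] with r hr using hB r (le_of_lt hr)
  calc supNorm u ≤ ((ENNReal.ofReal B : ENNReal) : EReal) :=
        EReal.coe_ennreal_le_coe_ennreal_iff.mpr h1
    _ = B := by rw [EReal.coe_ennreal_ofReal, max_eq_left hB0]

/-- If |u(0)| exceeded the norm, so would |u| on some (0, δ), a set of positive measure. -/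
theorem le_supNorm (hu : ContinuousWithinAt u (Ici 0) 0) : ((|u 0| : ℝ) : EReal) ≤ supNorm u := by
  have h1 : ENNReal.ofReal |u 0| ≤ eLpNorm u ⊤ (volume.restrict (Ioi (0 : ℝ))) := by
    by_contra hlt
    rw [not_le, ← Real.enorm_eq_ofReal_abs] at hlt
    have hev : ∀ᶠ r in 𝓝[Ici 0] (0 : ℝ),
        eLpNorm u ⊤ (volume.restrict (Ioi (0 : ℝ))) < ‖u r‖ₑ :=
      hu.enorm.eventually_const_lt hlt
    obtain ⟨δ, hδ, hball⟩ := Metric.mem_nhdsWithin_iff.mp hev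
    have h2 : ∀ᵐ r ∂volume.restrict (Ioo (0 : ℝ) δ),
        ‖u r‖ₑ ≤ eLpNorm u ⊤ (volume.restrict (Ioi (0 : ℝ))) := by
      rw [eLpNorm_exponent_top]
      exact ae_restrict_of_ae_restrict_of_subset Ioo_subset_Ioi_self ae_le_eLpNormEssSup
    have hne : (ae (volume.restrict (Ioo (0 : ℝ) δ))).NeBot := by
      rw [ae_neBot, Ne, Measure.restrict_eq_zero]
      simp [hδ]
    obtain ⟨r, h3, h4⟩ := (h2.and (ae_restrict_mem measurableSet_Ioo)).exists
    refine absurd h3 (not_le.mpr (hball ⟨?_, h4.1.le⟩))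
    rw [Metric.mem_ball, Real.dist_eq, sub_zero, abs_of_pos h4.1]
    exact h4.2
  calc ((|u 0| : ℝ) : EReal) = ((ENNReal.ofReal |u 0| : ENNReal) : EReal) := by
        rw [EReal.coe_ennreal_ofReal, max_eq_left (abs_nonneg _)]
    _ ≤ supNorm u := EReal.coe_ennreal_le_coe_ennreal_iff.mpr h1

theorem absIncreasesToInfinity_of_strictMonoOn {v : ℝ → ℝ} (hv : StrictMonoOn v (dom R))
    (hR : 0 < R) (h0 : 0 < v 0) (hM : ∀ M : ℝ, ∃ r₀ ∈ dom R, ∀ r ∈ dom R, r₀ ≤ r → M < v r)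
    (huv : ∀ r, |u r| = |v r|) : AbsIncreasesToInfinity R u := by
  have habs : ∀ r ∈ dom R, |u r| = v r := fun r hr => by
    rw [huv, abs_of_pos (h0.trans_le (hv.monotoneOn (zero_mem_dom hR) hr hr.1))]
  refine ⟨hv.congr fun r hr => (habs r hr).symm, fun M => ?_⟩
  obtain ⟨r₀, h1, h2⟩ := hM M
  exact ⟨r₀, h1, fun r hr hrr => (habs r hr).symm ▸ h2 r hr hrr⟩

theorem RadialODE.eq_const (h : RadialODE n a b g R u p) (hn : 0 ≤ n) (ha : 0 < a) (hb : 0 < b)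
    (hg : LocallyLipschitz g) (h0 : g (u 0) = 0) {r : ℝ} (hr : r ∈ dom R) : u r = u 0 := by
  refine h.eqOn hn ha hb hg (v := fun _ => u 0) (q := fun _ => 0)
    ⟨continuousOn_const, continuousOn_const, rfl, fun r _ _ => hasDerivAt_const _ _,
      fun r _ _ => ?_⟩ rfl hr
  rw [acc_zero_right, force, h0, pl_zero, neg_zero]
  exact hasDerivAt_const _ _

theorem eq_zero_of_sign_change (hg : Continuous g) {c : ℝ} (hc : 0 < c)
    (hpos : ∀ s, 0 < s → s < c → 0 < g s) (hneg : ∀ s, c < s → g s < 0) : g c = 0 := by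
  refine le_antisymm ?_ ?_
  · refine le_of_tendsto (hg.continuousWithinAt (s := Ioi c) (x := c)) ?_
    filter_upwards [self_mem_nhdsWithin] with s hs using (hneg s hs).le
  · refine ge_of_tendsto (hg.continuousWithinAt (s := Iio c) (x := c)) ?_
    filter_upwards [Ioo_mem_nhdsLT hc] with s hs using (hpos s hs.1 hs.2).le

end

/-! ### Assembly of the four cases -/

/-- Common end of cases 3 and 4: a bound B < α gives s g(s) > 0 for 0 < |s| ≤ B, which is all that
decay requires beyond global existence. -/
theorem IsMaximalSolution.global_of_abs_le {N : ℕ} (hN : 2 ≤ N) {a b : ℝ} (ha : 0 < a)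
    (hb : 0 < b) {g : ℝ → ℝ} (hg : LocallyLipschitz g) (hodd : ∀ s, g (-s) = -g s)
    (hg0 : g 0 = 0) {α : EReal} (hpos : ∀ s : ℝ, 0 < s → (s : EReal) < α → 0 < g s)
    (hgd : DifferentiableAt ℝ g 0) (hgpos : 0 < deriv g 0) {ξ : ℝ} {R : EReal} {u : ℝ → ℝ}
    (h : IsMaximalSolution N a b g ξ R u) {B : ℝ} (hBα : (B : EReal) < α)
    (hB : ∀ r ∈ dom R, |u r| ≤ B) :
    R = ⊤ ∧ Oscillating u ∧ Localized u ∧ supNorm u ≤ (B : EReal) ∧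
      ((|ξ| : ℝ) : EReal) ≤ supNorm u := by
  obtain rfl : R = ⊤ := h.eq_top_of_bounded (by omega) ha hb hg hg0 hB
  have hn : (0 : ℝ) < (N : ℝ) - 1 := by
    have : (2 : ℝ) ≤ N := by exact_mod_cast hN
    linarith
  have hode := h.1.radialODE ha hb
  have hB' : ∀ r, 0 ≤ r → |u r| ≤ B := fun r hr => hB r ⟨hr, EReal.coe_lt_top r⟩
  have hsign : ∀ s, s ≠ 0 → |s| ≤ B → 0 < s * g s := by
    intro s hs hsB
    have hlt := hpos |s| (abs_pos.mpr hs) ((EReal.coe_le_coe_iff.mpr hsB).trans_lt hBα)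
    rcases lt_or_gt_of_ne hs with h1 | h1
    · rw [abs_of_neg h1, hodd] at hlt
      nlinarith
    · rw [abs_of_pos h1] at hlt
      exact mul_pos h1 hlt
  refine ⟨rfl, hode.oscillating hn.le ha hb hodd hg0 hgd hgpos
    (hode.tendsto_zero hn ha hb hg.continuous hB' hsign).1,
    hode.localized hn ha hb hg.continuous hg0 hB' hsign, supNorm_le hB', ?_⟩
  rw [← h.1.init]
  refine le_supNorm ?_
  have := hode.continuousOn_left 0 (zero_mem_dom h.1.pos)
  rwa [dom_top] at this

end PucciRadial

theorem theorem3p2 (N : ℕ) (hN : 2 ≤ N) (lam Lam : ℝ) (hlam : 0 < lam) (hlamLam : lam ≤ Lam)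
    (g : ℝ → ℝ) (α : EReal)
    (hg1 : LocallyLipschitz g)
    (hg2 : ∀ s : ℝ, g (-s) = -g s)
    (hα : 0 < α)
    (hg3_pos : ∀ s : ℝ, 0 < s → (s : EReal) < α → 0 < g s)
    (hg3_neg : ∀ s : ℝ, α < (s : EReal) → g s < 0)
    (hg4_diff : DifferentiableAt ℝ g 0)
    (hg4_pos : 0 < deriv g 0)
    (ξ : ℝ) :
    (∃ (R : EReal) (u : ℝ → ℝ), PucciRadial.IsMaximalSolution N lam Lam g ξ R u) ∧
    ∀ (R : EReal) (u : ℝ → ℝ), PucciRadial.IsMaximalSolution N lam Lam g ξ R u →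
      ((((|ξ| : ℝ) : EReal) = α ∨ ξ = 0) → ∀ r ∈ PucciRadial.dom R, u r = ξ) ∧
      (α < ((|ξ| : ℝ) : EReal) → PucciRadial.AbsIncreasesToInfinity R u) ∧
      (0 < ξ → (ξ : EReal) < α →
        R = ⊤ ∧ PucciRadial.Oscillating u ∧ PucciRadial.Localized u ∧
          PucciRadial.supNorm u = (ξ : EReal) ∧ PucciRadial.supNorm u < α) ∧
      (-α < (ξ : EReal) → ξ < 0 →
        ((Lam * PucciRadial.potential g ξ : ℝ) : EReal)
          ≤ (lam : EReal) * PucciRadial.potentialAt g α →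
        R = ⊤ ∧ PucciRadial.Oscillating u ∧ PucciRadial.Localized u ∧
          PucciRadial.supNorm u < α) := by
  have hLam : 0 < Lam := hlam.trans_le hlamLam
  have hg0 : g 0 = 0 := by
    have := hg2 0
    rw [neg_zero] at this
    linarith
  have hn : (0 : ℝ) < (N : ℝ) - 1 := by
    have : (2 : ℝ) ≤ N := by exact_mod_cast hN
    linarith
  refine ⟨PucciRadial.exists_isMaximalSolution_of_exists (by omega) hlam hLam hg1
    (PucciRadial.exists_isSolution (by omega) hlam hLam hg1 ξ), fun R u hu => ?_⟩
  have hode := hu.1.radialODE hlam hLam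
  have hinit := hu.1.init
  refine ⟨fun hξ r hr => ?_, fun hξ => ?_, fun hξ hξα => ?_, fun hξα hξ hG => ?_⟩
  · have hgξ : g ξ = 0 := by
      rcases hξ with hξ | rfl
      · subst hξ
        have habs : g |ξ| = 0 := PucciRadial.eq_zero_of_sign_change hg1.continuous
          (by exact_mod_cast hα) (fun s h0 h1 => hg3_pos s h0 (by exact_mod_cast h1))
          fun s h1 => hg3_neg s (by exact_mod_cast h1)
        rcases abs_choice ξ with h1 | h1
        · rwa [h1] at habs
        · rw [h1, hg2] at habs
          linarith
      · exact hg0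
    rw [hode.eq_const hn.le hlam hLam hg1 (by rw [hinit, hgξ]) hr, hinit]
  · lift α to ℝ using ⟨(hξ.trans (EReal.coe_lt_top _)).ne, (EReal.bot_lt_zero.trans hα).ne'⟩
    have hα0 : 0 < α := by exact_mod_cast hα
    have hξ' : α < |ξ| := by exact_mod_cast hξ
    have hneg : ∀ s, α < s → g s < 0 := fun s hs => hg3_neg s (by exact_mod_cast hs)
    have htop : ∀ M : ℝ, (∀ r ∈ PucciRadial.dom R, |u r| ≤ M) → R = ⊤ := fun M hM =>
      hu.eq_top_of_bounded (by omega) hlam hLam hg1 hg0 hM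
    rcases lt_abs.mp hξ' with h1 | h1
    · obtain ⟨h2, h3⟩ := hode.strictMonoOn_and_unbounded hu.1.pos hn.le hlam hLam hg1.continuous
        (by rwa [hinit]) hneg htop
      exact PucciRadial.absIncreasesToInfinity_of_strictMonoOn h2 hu.1.pos
        (by rw [hinit]; linarith) h3 fun r => rfl
    -- For ξ < -α the result is applied to -u, with the two ellipticity constants exchanged.
    · obtain ⟨h2, h3⟩ := (hode.neg hg2).strictMonoOn_and_unbounded hu.1.pos hn.le hLam hlam
        hg1.continuous (by rwa [hinit]) hneg (by simpa using htop)
      exact PucciRadial.absIncreasesToInfinity_of_strictMonoOn h2 hu.1.pos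
        (by rw [hinit]; linarith) h3 fun r => (abs_neg (u r)).symm
  -- Here the bound B is ξ itself, so the two estimates of the sup norm coincide.
  · obtain ⟨h1, h2, h3, h4, h5⟩ := hu.global_of_abs_le hN hlam hLam hg1 hg2 hg0 hg3_pos hg4_diff
      hg4_pos hξα fun r hr => by
        rw [← hinit]
        exact hode.abs_le_of_pos hn.le hlam hlamLam hg1.continuous hg0 hg2 hg3_pos
          (by rwa [hinit]) (by rwa [hinit]) hr
    rw [abs_of_pos hξ] at h5
    exact ⟨h1, h2, h3, le_antisymm h4 h5, h4.trans_lt hξα⟩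
  · have hξα' : ((-ξ : ℝ) : EReal) < α := by
      rw [EReal.coe_neg]
      exact EReal.neg_lt_comm.mp hξα
    obtain ⟨B, hBα, hB⟩ := hode.exists_abs_le_of_neg hu.1.pos hn hlam hLam hg1.continuous hg0 hg2
      hα hg3_pos (by rwa [hinit]) (by rwa [hinit]) (by rwa [hinit])
    obtain ⟨h1, h2, h3, h4, -⟩ := hu.global_of_abs_le hN hlam hLam hg1 hg2 hg0 hg3_pos hg4_diff
      hg4_pos hBα hB
    exact ⟨h1, h2, h3, h4.trans_lt hBα⟩
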